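/- Let $X$ be a separable real Banach space, $\Omega\subset X$ open, and $\Gamma\to\Omega$ a $C^3$-smooth real Banach Lie group bundle: a locally trivial bundle of groups $\Gamma_x$, $x\in\Omega$, whose fiber type is a real Banach Lie group $G$ (of class $C^3$), whose local trivializations are fiberwise group isomorphisms onto $G$, and whose changes of trivialization are of class $C^3$. Let $\dot\Gamma\to\Omega$ be the associated Banach Lie algebra bundle, $\dot\Gamma_x=T_1\Gamma_x$, with a continuous norm $|\cdot|_x:\dot\Gamma_x\to[0,\infty)$ (a norm on each fiber, continuous as a function on the total space of $\dot\Gamma$), and let $\exp_x:\dot\Gamma_x\to\Gamma_x$ be the exponential map. Let $P\to\Omega$ be a $C^3$-smooth right $\Gamma$-principal bundle, i.e., a $C^3$-smooth bundle with a fiberwise right action of $\Gamma$ that is locally $C^3$-isomorphic to $\Gamma$ acting on itself by right translations. For $p,q\in P_x$ let $p^{-1}q$ be the unique $a\in\Gamma_x$ with $pa=q$. A normal neighborhood is an open neighborhood $N\subset\dot\Gamma$ of the zero section that the map $\exp:\dot\Gamma\to\Gamma$ sends homeomorphically onto an open subset of $\Gamma$; given $N$, let $N_x=N\cap\dot\Gamma_x$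 and let $\log_x:\exp_x(N_x)\to N_x$ be the inverse of $\exp_x|_{N_x}$. A section of $P$ is locally Lipschitz if it is so in local trivializations of $P$ and charts of $G$. Normal neighborhoods exist, and the following hold. (8.2) Let $N$ be any normal neighborhood. For any continuous section $f$ of $P$ and any continuous $\varepsilon:\Omega\to(0,\infty)$ there is a locally Lipschitz section $g$ of $P$ such that, for all $x\in\Omega$, $f(x)^{-1}g(x)\in\exp_x(N_x)$ and $|\log_x f(x)^{-1}g(x)|_x\le\varepsilon(x)$. (8.1) For any continuous section $f$ of $P$ there are a locally Lipschitz section $g$ of $P$ and a continuous map $h:\Omega\times[0,1]\to P$ such that $h(x,t)\in P_x$, $h(x,0)=f(x)$ and $h(x,1)=g(x)$ for all $(x,t)\in\Omega\times[0,1]$. -/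

import Mathlib

open Set Filter Topology Bundle TopologicalSpace MulOpposite
open scoped Manifold ContDiff NNReal
noncomputable section

/-! ### `C^n` fibre bundles, Lie group bundles, principal bundles over an open set -/

section Bundles

variable {X : Type*} [NormedAddCommGroup X] [NormedSpace ℝ X] (Ω : Opens X)
  (E : Type*) [NormedAddCommGroup E] [NormedSpace ℝ E]
  (G : Type*) [TopologicalSpace G] [ChartedSpace E G]

/-- A fibre bundle `F` over the open set `Ω ⊆ X`, with typical fibre the manifold `G` modelled on
`E`, is a `C^n` bundle if the changes of trivialization
`(x, a) ↦ e' (e⁻¹ (x, a))` between members of its trivialization atlas are of class `C^n`. -/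
class IsContMDiffFiberBundle (n : WithTop ℕ∞) (F : Ω → Type*) [TopologicalSpace (TotalSpace G F)]
    [∀ x, TopologicalSpace (F x)] [FiberBundle G F] : Prop where
  contMDiffOn_coordChange : ∀ e ∈ FiberBundle.trivializationAtlas G F,
    ∀ e' ∈ FiberBundle.trivializationAtlas G F,
      ContMDiffOn (𝓘(ℝ, X).prod 𝓘(ℝ, E)) 𝓘(ℝ, E) n
        (fun p : Ω × G => (e' (e.toOpenPartialHomeomorph.symm p)).2)
        ((e.baseSet ∩ e'.baseSet) ×ˢ univ)

/-- A fibre bundle `Γ → Ω` of groups with typical fibre the Lie group `G` is a `C^n` Lie group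
bundle if it is a `C^n` bundle and its trivializations are fibrewise group homomorphisms
(hence group isomorphisms `Γ x ≃ G`). -/
class IsLieGroupBundle [Group G] (n : WithTop ℕ∞) (Γ : Ω → Type*)
    [TopologicalSpace (TotalSpace G Γ)] [∀ x, TopologicalSpace (Γ x)] [∀ x, Group (Γ x)]
    [FiberBundle G Γ] : Prop extends IsContMDiffFiberBundle Ω E G n Γ where
  map_mul : ∀ e ∈ FiberBundle.trivializationAtlas G Γ, ∀ x ∈ e.baseSet, ∀ a b : Γ x,
    (e ⟨x, a * b⟩).2 = (e ⟨x, a⟩).2 * (e ⟨x, b⟩).2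

/-- A `C^n` bundle `P → Ω` with a fibrewise right action of the group bundle `Γ → Ω` (a right
action of `Γ x` is an action of `(Γ x)ᵐᵒᵖ`) is a right `Γ`-principal bundle if it is locally
isomorphic to `Γ` acting on itself by right translations: near each point of `Ω` there are
trivializations `e` of `P` and `τ` of `Γ` with `e (p · a) = e p * τ a`. -/
class IsRightPrincipalBundle [Group G] (n : WithTop ℕ∞)
    (Γ : Ω → Type*) [TopologicalSpace (TotalSpace G Γ)] [∀ x, TopologicalSpace (Γ x)]
    [∀ x, Group (Γ x)] [FiberBundle G Γ]
    (P : Ω → Type*) [TopologicalSpace (TotalSpace G P)] [∀ x, TopologicalSpace (P x)]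
    [FiberBundle G P] [∀ x, MulAction (Γ x)ᵐᵒᵖ (P x)] : Prop
    extends IsContMDiffFiberBundle Ω E G n P where
  exists_equivariant : ∀ x₀ : Ω, ∃ e ∈ FiberBundle.trivializationAtlas G P,
    ∃ τ ∈ FiberBundle.trivializationAtlas G Γ, x₀ ∈ e.baseSet ∩ τ.baseSet ∧
      ∀ x ∈ e.baseSet ∩ τ.baseSet, ∀ (p : P x) (a : Γ x),
        (e ⟨x, op a • p⟩).2 = (e ⟨x, p⟩).2 * (τ ⟨x, a⟩).2

end Bundles

/-- In a fibre of a right principal bundle, `torsorDiv p q = p⁻¹ q` is the (unique) group element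
`a` with `p · a = q`. -/
def torsorDiv {A Q : Type*} [Group A] [MulAction Aᵐᵒᵖ Q] (p q : Q) : A :=
  Classical.epsilon fun a : A => op a • p = q

/-! ### Sections -/

section Sections

variable {X : Type*} [NormedAddCommGroup X] {Ω : Opens X}

/-- A map `u` from a metric space to a manifold modelled on `E` is locally Lipschitz at `y` if it
is continuous at `y` and is Lipschitz near `y` when read in the chart at `u y`. -/
def LocallyLipschitzAt {Y : Type*} [PseudoEMetricSpace Y] (E : Type*) [NormedAddCommGroup E]
    [NormedSpace ℝ E] {G : Type*} [TopologicalSpace G] [ChartedSpace E G] (u : Y → G) (y : Y) :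
    Prop :=
  ContinuousAt u y ∧ ∃ K : ℝ≥0, ∃ s ∈ 𝓝 y,
    LipschitzOnWith K (fun z => extChartAt 𝓘(ℝ, E) (u y) (u z)) s

variable (E : Type*) [NormedAddCommGroup E] [NormedSpace ℝ E]
  (G : Type*) [TopologicalSpace G] [ChartedSpace E G]
  {P : Ω → Type*} [TopologicalSpace (TotalSpace G P)] [∀ x, TopologicalSpace (P x)]
  [FiberBundle G P]

/-- The section `f` is continuous, as a map into the total space. -/
def IsContinuousSection (f : ∀ x, P x) : Prop :=
  Continuous fun x => (⟨x, f x⟩ : TotalSpace G P)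

/-- The section `g` is locally Lipschitz: it is so in every local trivialization. -/
def IsLocallyLipschitzSection (g : ∀ x, P x) : Prop :=
  ∀ e ∈ FiberBundle.trivializationAtlas G P, ∀ x ∈ e.baseSet,
    LocallyLipschitzAt E (fun z => (e ⟨z, g z⟩).2) x

end Sections

/-! ### The Lie algebra bundle -/

section LieAlgebraBundle

variable {X : Type*} [NormedAddCommGroup X] [NormedSpace ℝ X] {Ω : Opens X}
  (E : Type*) [NormedAddCommGroup E] [NormedSpace ℝ E]
  (G : Type*) [TopologicalSpace G] [ChartedSpace E G] [Group G]
  (Γ : Ω → Type*) [TopologicalSpace (TotalSpace G Γ)] [∀ x, TopologicalSpace (Γ x)]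
  [∀ x, Group (Γ x)] [FiberBundle G Γ]

variable {G Γ} in
/-- The change of trivialization over the point `x`, a map `G → G`. -/
def fiberCoordChange (e e' : Trivialization G (π G Γ)) (x : Ω) (a : G) : G :=
  (e' (e.toOpenPartialHomeomorph.symm (x, a))).2

variable {G Γ} in
/-- The derivative at `1` of the change of trivialization over `x`; here `T₁ G = E`. -/
def lieCoordChange (e e' : Trivialization G (π G Γ)) (x : Ω) : E →L[ℝ] E :=
  mfderiv 𝓘(ℝ, E) 𝓘(ℝ, E) (fiberCoordChange e e' x) (1 : G)

variable {E G Γ}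

lemma exists_eq_symm (e : Trivialization G (π G Γ)) {x : Ω} (hx : x ∈ e.baseSet) (a : G) :
    ∃ b : Γ x, e.toOpenPartialHomeomorph.symm (x, a) = ⟨x, b⟩ ∧ e ⟨x, b⟩ = (x, a) := by
  have h1 : (e.toOpenPartialHomeomorph.symm (x, a)).1 = x := e.proj_symm_apply' hx
  have h2 : e (e.toOpenPartialHomeomorph.symm (x, a)) = (x, a) := e.apply_symm_apply' hx
  generalize e.toOpenPartialHomeomorph.symm (x, a) = z at h1 h2
  obtain ⟨y, b⟩ := z
  obtain rfl : y = x := h1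
  exact ⟨b, rfl, h2⟩

lemma fiberCoordChange_self (e : Trivialization G (π G Γ)) {x : Ω} (hx : x ∈ e.baseSet) :
    fiberCoordChange e e x = id := by
  funext a
  obtain ⟨b, hb, hb'⟩ := exists_eq_symm e hx a
  simp [fiberCoordChange, hb, hb']

lemma fiberCoordChange_comp (e e' e'' : Trivialization G (π G Γ)) {x : Ω} (hx : x ∈ e.baseSet)
    (hx' : x ∈ e'.baseSet) :
    fiberCoordChange e' e'' x ∘ fiberCoordChange e e' x = fiberCoordChange e e'' x := by
  funext a
  obtain ⟨b, hb, hb'⟩ := exists_eq_symm e hx a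
  have h : e'.toOpenPartialHomeomorph.symm (x, (e' ⟨x, b⟩).2) = ⟨x, b⟩ := by
    have h1 : (e' (⟨x, b⟩ : TotalSpace G Γ)).1 = x := e'.coe_fst' hx'
    have : (x, (e' ⟨x, b⟩).2) = e' ⟨x, b⟩ := Prod.ext h1.symm rfl
    rw [this]
    exact e'.toOpenPartialHomeomorph.left_inv (e'.mem_source.2 hx')
  simp [fiberCoordChange, hb, h]

variable (E) in
lemma fiberCoordChange_one [IsLieGroupBundle Ω E G 3 Γ] {e e' : Trivialization G (π G Γ)}
    (he : e ∈ FiberBundle.trivializationAtlas G Γ) (he' : e' ∈ FiberBundle.trivializationAtlas G Γ)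
    {x : Ω} (hx : x ∈ e.baseSet) (hx' : x ∈ e'.baseSet) : fiberCoordChange e e' x 1 = 1 := by
  have key : ∀ e ∈ FiberBundle.trivializationAtlas G Γ, x ∈ e.baseSet →
      (e (⟨x, 1⟩ : TotalSpace G Γ)).2 = 1 := fun e he hx => by
    have h := IsLieGroupBundle.map_mul (Ω := Ω) (E := E) (n := 3) e he x hx 1 1
    rw [mul_one] at h
    exact left_eq_mul.1 h
  have h : e.toOpenPartialHomeomorph.symm (x, 1) = (⟨x, 1⟩ : TotalSpace G Γ) := by
    have h1 : (e (⟨x, 1⟩ : TotalSpace G Γ)).1 = x := e.coe_fst' hx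
    have : (x, (1 : G)) = e (⟨x, 1⟩ : TotalSpace G Γ) := Prod.ext h1.symm (key e he hx).symm
    rw [this]
    exact e.toOpenPartialHomeomorph.left_inv (e.mem_source.2 hx)
  simp only [fiberCoordChange, h]
  exact key e' he' hx'

variable [IsLieGroupBundle Ω E G 3 Γ]

lemma contMDiffAt_coordChange {e e' : Trivialization G (π G Γ)}
    (he : e ∈ FiberBundle.trivializationAtlas G Γ) (he' : e' ∈ FiberBundle.trivializationAtlas G Γ)
    {x : Ω} (hx : x ∈ e.baseSet ∩ e'.baseSet) (a : G) :
    ContMDiffAt (𝓘(ℝ, X).prod 𝓘(ℝ, E)) 𝓘(ℝ, E) 3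
      (Function.uncurry (fiberCoordChange e e')) (x, a) :=
  (IsContMDiffFiberBundle.contMDiffOn_coordChange e he e' he' : ContMDiffOn _ _ _ _ _).contMDiffAt
    (((e.open_baseSet.inter e'.open_baseSet).prod isOpen_univ).mem_nhds ⟨hx, mem_univ _⟩)

lemma mdifferentiableAt_fiberCoordChange {e e' : Trivialization G (π G Γ)}
    (he : e ∈ FiberBundle.trivializationAtlas G Γ) (he' : e' ∈ FiberBundle.trivializationAtlas G Γ)
    {x : Ω} (hx : x ∈ e.baseSet ∩ e'.baseSet) (a : G) :
    MDifferentiableAt 𝓘(ℝ, E) 𝓘(ℝ, E) (fiberCoordChange e e' x) a :=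
  ((contMDiffAt_coordChange he he' hx a).comp a
    (contMDiffAt_const.prodMk contMDiffAt_id :
      ContMDiffAt 𝓘(ℝ, E) (𝓘(ℝ, X).prod 𝓘(ℝ, E)) 3 (fun b : G => (x, b)) a)).mdifferentiableAt
    (by norm_num)

variable [LieGroup 𝓘(ℝ, E) 3 G]

lemma continuousOn_lieCoordChange {e e' : Trivialization G (π G Γ)}
    (he : e ∈ FiberBundle.trivializationAtlas G Γ)
    (he' : e' ∈ FiberBundle.trivializationAtlas G Γ) :
    ContinuousOn (lieCoordChange E e e') (e.baseSet ∩ e'.baseSet) := by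
  intro x₀ hx₀
  have : IsManifold 𝓘(ℝ, E) 1 G := IsManifold.of_le (n := 3) (by norm_num)
  have h := ((contMDiffAt_coordChange (E := E) he he' hx₀ 1).mfderiv (m := 0)
    (fiberCoordChange e e') (fun _ => (1 : G)) contMDiffAt_const (by norm_num)).continuousAt
  refine ContinuousAt.continuousWithinAt (h.congr ?_)
  filter_upwards [(e.open_baseSet.inter e'.open_baseSet).mem_nhds hx₀] with x hx
  have h1 := fiberCoordChange_one E he he' hx.1 hx.2
  have h0 := fiberCoordChange_one E he he' hx₀.1 hx₀.2
  have hs : (1 : G) ∈ (tangentBundleCore 𝓘(ℝ, E) G).baseSet (achart E (1 : G)) :=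
    mem_chart_source E (1 : G)
  refine (inTangentCoordinates_eq (I := 𝓘(ℝ, E)) (I' := 𝓘(ℝ, E)) (fun _ => (1 : G))
    (fun x => fiberCoordChange e e' x 1) (lieCoordChange E e e') (x₀ := x₀) (x := x) hs
    (by rw [h1, h0]; exact hs)).trans ?_
  ext v
  simp only [ContinuousLinearMap.comp_apply, h1, h0]
  rw [(tangentBundleCore 𝓘(ℝ, E) G).coordChange_self _ _ hs,
    (tangentBundleCore 𝓘(ℝ, E) G).coordChange_self _ _ hs]

variable (E G Γ)

/-- The Lie algebra bundle `Γ̇ → Ω` of the Lie group bundle `Γ`: its fibre `Γ̇ x = T₁ (Γ x)` is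
identified with `T₁ G = E` by a trivialization of `Γ`, and its coordinate changes are the
derivatives at `1` of those of `Γ`. As usual for vector bundle cores, the type of `Γ̇ x` is `E`,
with `v : E` standing for the tangent vector whose coordinate in the preferred
trivialization of `Γ` at `x` is `v`. -/
def lieAlgebraBundle : VectorBundleCore ℝ Ω E (FiberBundle.trivializationAtlas G Γ) where
  baseSet e := e.1.baseSet
  isOpen_baseSet e := e.1.open_baseSet
  indexAt x := ⟨FiberBundle.trivializationAt G Γ x, FiberBundle.trivialization_mem_atlas G Γ x⟩
  mem_baseSet_at x := FiberBundle.mem_baseSet_trivializationAt G Γ x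
  coordChange e e' x := lieCoordChange E e.1 e'.1 x
  coordChange_self e x hx v := by
    have h : lieCoordChange E e.1 e.1 x = ContinuousLinearMap.id ℝ E := by
      unfold lieCoordChange
      rw [fiberCoordChange_self e.1 hx]
      exact mfderiv_id
    rw [h]
    rfl
  continuousOn_coordChange e e' := continuousOn_lieCoordChange e.2 e'.2
  coordChange_comp e e' e'' x hx v := by
    have h := (mdifferentiableAt_fiberCoordChange (E := E) e.2 e'.2 hx.1 1).hasMFDerivAt
    have h' := (mdifferentiableAt_fiberCoordChange (E := E) e'.2 e''.2 ⟨hx.1.2, hx.2⟩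
      (fiberCoordChange e.1 e'.1 x 1)).hasMFDerivAt
    have h'' := (h'.comp (1 : G) h).mfderiv
    rw [fiberCoordChange_comp _ _ _ hx.1.1 hx.1.2] at h''
    simp only [lieCoordChange]
    rw [h'', fiberCoordChange_one E e.2 e'.2 hx.1.1 hx.1.2]
    rfl

/-- The fibre `Γ̇ x`. -/
abbrev LieFiber (x : Ω) : Type _ := (lieAlgebraBundle E G Γ).Fiber x

/-! ### Exponential map, normal neighbourhoods, logarithm -/

variable {E G} in
/-- The exponential map of the Lie group `G`: `exp v = γ 1`, where `γ` is the integral curve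
with `γ 0 = 1` of the left invariant vector field given by `v`. -/
def lieExp (v : GroupLieAlgebra 𝓘(ℝ, E) G) : G :=
  Classical.epsilon fun a => ∃ γ : ℝ → G, γ 0 = 1 ∧
    IsMIntegralCurve γ (mulInvariantVectorField v) ∧ γ 1 = a

/-- The exponential map `exp_x : Γ̇ x → Γ x`, obtained from that of `G` through the preferred
trivialization of `Γ` at `x`, a group isomorphism `Γ x ≃ G`. -/
def fiberExp (x : Ω) (v : LieFiber E G Γ x) : Γ x :=
  Function.invFun (fun a : Γ x => (FiberBundle.trivializationAt G Γ x ⟨x, a⟩).2)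
    (lieExp (E := E) (G := G) v)

/-- The exponential map as a map `Γ̇ → Γ` of total spaces. -/
def bundleExp (v : TotalSpace E (LieFiber E G Γ)) : TotalSpace G Γ :=
  ⟨v.1, fiberExp E G Γ v.1 v.2⟩

/-- A normal neighbourhood (of the zero section): an open neighbourhood of the zero section of
`Γ̇` that the exponential map sends homeomorphically onto an open subset of `Γ`. -/
structure IsNormalNeighborhood (N : Set (TotalSpace E (LieFiber E G Γ))) : Prop where
  isOpen : IsOpen N
  zero_mem : ∀ x : Ω, (⟨x, 0⟩ : TotalSpace E (LieFiber E G Γ)) ∈ N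
  isOpenEmbedding : IsOpenEmbedding (N.domRestrict (bundleExp E G Γ))

variable {E G Γ}

/-- The part `N x` of the normal neighbourhood `N` in the fibre `Γ̇ x`. -/
def fiberPart (N : Set (TotalSpace E (LieFiber E G Γ))) (x : Ω) : Set (LieFiber E G Γ x) :=
  {v | (⟨x, v⟩ : TotalSpace E (LieFiber E G Γ)) ∈ N}

/-- The logarithm `log_x`, inverse of `exp_x : N x → exp_x (N x)`, for a normal neighbourhood
`N`. -/
def fiberLog (N : Set (TotalSpace E (LieFiber E G Γ))) (x : Ω) (a : Γ x) : LieFiber E G Γ x :=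
  Function.invFunOn (fiberExp E G Γ x) (fiberPart N x) a

variable (E G Γ)

/-- A continuous norm on the Lie algebra bundle: a norm on each fibre `Γ̇ x`, continuous as a
function on the total space. -/
structure ContinuousNorm where
  toFun : ∀ x : Ω, Seminorm ℝ (LieFiber E G Γ x)
  eq_zero : ∀ (x : Ω) (v : LieFiber E G Γ x), toFun x v = 0 → v = 0
  continuous : Continuous fun v : TotalSpace E (LieFiber E G Γ) => toFun v.1 v.2

end LieAlgebraBundle

end

/-!
Read in a chart of `G` at `1`, one-parameter subgroups are the integral curves of `y' = A(y) v` with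
`A` locally Lipschitz and `A = id` at the image of `1`. By Picard–Lindelöf and Grönwall the time-one
map exists for small `v` and is strictly differentiable at `v = 0` with derivative the identity, so
the inverse function theorem makes `exp` a homeomorphism near `0`. Homomorphisms commute with
exponentials, so trivializations of the group bundle intertwine the fibrewise exponentials, and
balls shrinking suitably along a locally finite cover of the base form a normal neighbourhood with
starlike fibres.

A continuous section of a `C¹` bundle lying in an open set `W` can be moved inside `W` to a locally
Lipschitz one: countably many charts suffice because the base is Lindelöf, they are treated one at a
time, and within a chart one glues with locally Lipschitz partitions of unity, which exist because
the base is metric. Taking for `W` the neighbourhood `f · exp N` of `f`, with `N` shrunk to the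
vectors of norm less than `ε`, gives the approximation; for starlike `N` the path
`t ↦ f · exp (t log (f⁻¹ g))` gives the homotopy.
-/

section LocallyLipschitz

/-- The map `u` is locally Lipschitz at `y`, that is, Lipschitz on a neighbourhood of `y`: Mathlib's
`LocallyLipschitz` asks for this at every point. -/
def LipschitzNear {Y F : Type*} [PseudoEMetricSpace Y] [PseudoEMetricSpace F] (u : Y → F) (y : Y) :
    Prop :=
  ∃ K : ℝ≥0, ∃ s ∈ 𝓝 y, LipschitzOnWith K u s

namespace LipschitzNear

section PseudoEMetric

variable {Y Z F : Type*} [PseudoEMetricSpace Y] [PseudoEMetricSpace Z] [PseudoEMetricSpace F]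
  {y : Y}

lemma continuousAt {u : Y → Z} (hu : LipschitzNear u y) : ContinuousAt u y := by
  obtain ⟨K, s, hs, h⟩ := hu
  exact h.continuousOn.continuousAt hs

lemma congr {u v : Y → Z} (hu : LipschitzNear u y) (h : v =ᶠ[𝓝 y] u) : LipschitzNear v y := by
  obtain ⟨K, s, hs, hK⟩ := hu
  refine ⟨K, s ∩ {x | v x = u x}, inter_mem hs h, fun a ha b hb => ?_⟩
  rw [ha.2, hb.2]
  exact hK ha.1 hb.1

lemma comp {f : Z → F} {u : Y → Z} (hf : LipschitzNear f (u y)) (hu : LipschitzNear u y) :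
    LipschitzNear (fun x => f (u x)) y := by
  have hc := hu.continuousAt
  obtain ⟨K, s, hs, hK⟩ := hu
  obtain ⟨L, t, ht, hL⟩ := hf
  exact ⟨L * K, s ∩ u ⁻¹' t, inter_mem hs (hc ht),
    hL.comp (hK.mono inter_subset_left) ((mapsTo_preimage u t).mono_left inter_subset_right)⟩

lemma prodMk {f : Y → Z} {g : Y → F} (hf : LipschitzNear f y) (hg : LipschitzNear g y) :
    LipschitzNear (fun x => (f x, g x)) y := by
  obtain ⟨K, s, hs, hK⟩ := hf
  obtain ⟨L, t, ht, hL⟩ := hg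
  exact ⟨max K L, s ∩ t, inter_mem hs ht,
    (hK.mono inter_subset_left).prodMk (hL.mono inter_subset_right)⟩

end PseudoEMetric

lemma of_contDiffAt {E F : Type*} [NormedAddCommGroup E] [NormedSpace ℝ E]
    [NormedAddCommGroup F] [NormedSpace ℝ F] {f : E → F} {x : E} (hf : ContDiffAt ℝ 1 f x) :
    LipschitzNear f x :=
  hf.exists_lipschitzOnWith

section Normed

variable {Y E : Type*} [PseudoEMetricSpace Y] [NormedAddCommGroup E] [NormedSpace ℝ E] {y : Y}

lemma smul {a : Y → ℝ} {u : Y → E} (ha : LipschitzNear a y) (hu : LipschitzNear u y) :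
    LipschitzNear (fun x => a x • u x) y :=
  (of_contDiffAt (f := fun p : ℝ × E => p.1 • p.2) (contDiffAt_fst.smul contDiffAt_snd)).comp
    (ha.prodMk hu)

lemma add {u v : Y → E} (hu : LipschitzNear u y) (hv : LipschitzNear v y) :
    LipschitzNear (fun x => u x + v x) y :=
  (of_contDiffAt (f := fun p : E × E => p.1 + p.2) (contDiffAt_fst.add contDiffAt_snd)).comp
    (hu.prodMk hv)

lemma one_sub {a : Y → ℝ} (ha : LipschitzNear a y) : LipschitzNear (fun x => 1 - a x) y :=
  (of_contDiffAt (f := fun t : ℝ => 1 - t) (contDiffAt_const.sub contDiffAt_id)).comp ha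

lemma sum {ι : Type*} {u : ι → Y → E} (t : Finset ι) (h : ∀ i ∈ t, LipschitzNear (u i) y) :
    LipschitzNear (fun x => ∑ i ∈ t, u i x) y := by
  classical
  induction t using Finset.induction_on with
  | empty => exact LocallyLipschitz.const (0 : E) y
  | insert i t hi ih =>
    simp only [Finset.sum_insert hi]
    exact (h i (by simp)).add (ih fun j hj => h j (by simp [hj]))

lemma prod {ι : Type*} {a : ι → Y → ℝ} (t : Finset ι) (h : ∀ i ∈ t, LipschitzNear (a i) y) :
    LipschitzNear (fun x => ∏ i ∈ t, a i x) y := by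
  classical
  induction t using Finset.induction_on with
  | empty => exact LocallyLipschitz.const (1 : ℝ) y
  | insert i t hi ih =>
    simp only [Finset.prod_insert hi]
    exact (h i (by simp)).smul (ih fun j hj => h j (by simp [hj]))

end Normed

end LipschitzNear

variable {Y : Type*} [PseudoMetricSpace Y]

lemma LipschitzNear.exists_lipschitzOnWith_ball_norm_le {V : Type*} [NormedAddCommGroup V]
    {f : Y → V} {y₀ : Y} (hf : LipschitzNear f y₀) {U : Set Y} (hU : U ∈ 𝓝 y₀) :
    ∃ K M : ℝ≥0, ∃ ρ > 0, Metric.ball y₀ ρ ⊆ U ∧ LipschitzOnWith K f (Metric.ball y₀ ρ) ∧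
      ∀ y ∈ Metric.ball y₀ ρ, ‖f y‖ ≤ M := by
  have hM : ∀ᶠ y in 𝓝 y₀, ‖f y‖ < ‖f y₀‖₊ + 1 :=
    hf.continuousAt.norm.eventually_lt_const (lt_add_one _)
  obtain ⟨K, s, hs, hK⟩ := hf
  obtain ⟨ρ, hρ, hball⟩ := Metric.mem_nhds_iff.1 (inter_mem (inter_mem hs hU) hM)
  exact ⟨K, ‖f y₀‖₊ + 1, ρ, hρ, fun y hy => (hball hy).1.2, hK.mono fun y hy => (hball hy).1.1,
    fun y hy => (hball hy).2.le⟩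

lemma locallyLipschitz_infDist_div {s t : Set Y}
    (h : ∀ x, 0 < Metric.infDist x s + Metric.infDist x t) :
    LocallyLipschitz fun x => Metric.infDist x s / (Metric.infDist x s + Metric.infDist x t) :=
  fun y => (LipschitzNear.of_contDiffAt (f := fun p : ℝ × ℝ => p.1 / (p.1 + p.2))
    (contDiffAt_fst.div (contDiffAt_fst.add contDiffAt_snd) (h y).ne')).comp
      (u := fun x => (Metric.infDist x s, Metric.infDist x t))
      (((Metric.lipschitz_infDist_pt s).prodMk (Metric.lipschitz_infDist_pt t)).locallyLipschitz y)

lemma exists_locallyLipschitz_zero_one_of_isClosed {s t : Set Y} (hs : IsClosed s)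
    (ht : IsClosed t) (hd : Disjoint s t) :
    ∃ f : C(Y, ℝ), LocallyLipschitz f ∧ EqOn f 0 s ∧ EqOn f 1 t ∧ ∀ x, f x ∈ Icc (0 : ℝ) 1 := by
  rcases s.eq_empty_or_nonempty with rfl | hsn
  · exact ⟨1, .const 1, eqOn_empty _ _, fun _ _ => rfl, fun _ => by simp⟩
  rcases t.eq_empty_or_nonempty with rfl | htn
  · exact ⟨0, .const 0, fun _ _ => rfl, eqOn_empty _ _, fun _ => by simp⟩
  have hpos (x : Y) : 0 < Metric.infDist x s + Metric.infDist x t := by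
    by_cases hx : x ∈ s
    · exact add_pos_of_nonneg_of_pos Metric.infDist_nonneg
        ((ht.notMem_iff_infDist_pos htn).1 (disjoint_left.1 hd hx))
    · exact add_pos_of_pos_of_nonneg ((hs.notMem_iff_infDist_pos hsn).1 hx) Metric.infDist_nonneg
  have hlip := locallyLipschitz_infDist_div hpos
  refine ⟨⟨_, hlip.continuous⟩, hlip, fun x hx => ?_, fun x hx => ?_, fun x => ?_⟩
  · simp [(hs.mem_iff_infDist_zero hsn).1 hx]
  · have h0 := (ht.mem_iff_infDist_zero htn).1 hx
    simpa [h0] using div_self (by simpa [h0] using (hpos x).ne')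
  · exact ⟨div_nonneg Metric.infDist_nonneg (hpos x).le,
      (div_le_one (hpos x)).2 (le_add_of_nonneg_right Metric.infDist_nonneg)⟩

lemma locallyLipschitz_toPartitionOfUnity {ι : Type*} {C : Set Y} (b : BumpCovering ι Y C)
    (hb : ∀ i, LocallyLipschitz (b i)) (i : ι) : LocallyLipschitz (b.toPartitionOfUnity i) := by
  classical
  intro y
  obtain ⟨u, hu⟩ := b.exists_finset_toPartitionOfUnity_eventuallyEq i y
  refine LipschitzNear.congr ?_ hu
  refine LipschitzNear.congr (LipschitzNear.smul (hb i y) (LipschitzNear.prod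
    {j ∈ u | WellOrderingRel j i} fun j _ => LipschitzNear.one_sub (hb j y)))
    (Eventually.of_forall fun x => ?_)
  simp

variable {E : Type*} [NormedAddCommGroup E] [NormedSpace ℝ E] {C : Set Y}

lemma exists_locallyLipschitz_forall_mem_convex (hC : IsClosed C) {t : Y → Set E}
    (ht : ∀ x ∈ C, Convex ℝ (t x)) (H : ∀ x ∈ C, ∃ c : E, ∀ᶠ y in 𝓝[C] x, c ∈ t y) :
    ∃ w : Y → E, LocallyLipschitz w ∧ ∀ x ∈ C, w x ∈ t x := by
  choose! c hc using H
  obtain ⟨b, hb, hbU⟩ := BumpCovering.exists_isSubordinate_of_prop (fun f => LocallyLipschitz f)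
    (fun s t hs ht hd => exists_locallyLipschitz_zero_one_of_isClosed hs ht hd) hC
    (fun x : C => interior {y | y ∈ C → c x ∈ t y}) (fun x => isOpen_interior)
    fun x hx => mem_iUnion.2 ⟨⟨x, hx⟩, mem_interior_iff_mem_nhds.2
      (eventually_nhdsWithin_iff.1 (hc x hx))⟩
  have hρ := locallyLipschitz_toPartitionOfUnity b hb
  refine ⟨fun x => ∑ᶠ i, b.toPartitionOfUnity i x • c i, fun y => ?_, fun x hx =>
    b.toPartitionOfUnity.finsum_smul_mem_convex (g := fun i _ => c i) hx (fun i hi => ?_)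
      (ht x hx)⟩
  · obtain ⟨U, hU, hfin⟩ := b.toPartitionOfUnity.locallyFinite y
    refine LipschitzNear.congr (LipschitzNear.sum hfin.toFinset fun i _ =>
      LipschitzNear.smul (hρ i y) (LocallyLipschitz.const (c i) y)) ?_
    filter_upwards [hU] with x hx
    refine finsum_eq_sum_of_support_subset _ fun i hi => hfin.mem_toFinset.2 ⟨x, fun h => hi ?_, hx⟩
    simp [h]
  · exact interior_subset (hbU.toPartitionOfUnity i (subset_tsupport _ hi)) hx

lemma convex_setOf_exists_mem_ball_subset (a : E) (D : Set E) :
    Convex ℝ {c | ∃ r, c ∈ Metric.ball a r ∧ Metric.ball a r ⊆ D} := by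
  rintro b ⟨r, hb, hr⟩ c ⟨r', hc, hr'⟩ p q hp hq hpq
  rcases le_total r r' with h | h
  · exact ⟨r', convex_ball _ _ (Metric.ball_subset_ball h hb) hc hp hq hpq, hr'⟩
  · exact ⟨r, convex_ball _ _ hb (Metric.ball_subset_ball h hc) hp hq hpq, hr⟩

lemma exists_locallyLipschitz_segment_subset (hC : IsClosed C) {u : Y → E}
    (hu : ContinuousOn u C) {D : Set (Y × E)} (hD : IsOpen D) (hCD : ∀ x ∈ C, (x, u x) ∈ D) :
    ∃ w : Y → E, LocallyLipschitz w ∧ ∀ x ∈ C, ∀ c ∈ segment ℝ (u x) (w x), (x, c) ∈ D := by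
  obtain ⟨w, hw, hwD⟩ := exists_locallyLipschitz_forall_mem_convex hC
    (fun x _ => convex_setOf_exists_mem_ball_subset (u x) {c | (x, c) ∈ D}) fun x hx => by
      obtain ⟨ρ, hρ, hball⟩ := Metric.isOpen_iff.1 hD _ (hCD x hx)
      refine ⟨u x, ?_⟩
      filter_upwards [hu x hx (Metric.ball_mem_nhds (u x) (half_pos hρ)),
        mem_nhdsWithin_of_mem_nhds (Metric.ball_mem_nhds x hρ)] with y hy hyx
      refine ⟨ρ / 2, Metric.mem_ball_comm.1 hy, fun d hd => hball ?_⟩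
      rw [← ball_prod_same]
      exact ⟨hyx, Metric.ball_subset_ball' (by linarith [Metric.mem_ball.1 hy]) hd⟩
  refine ⟨w, hw, fun x hx c hc => ?_⟩
  obtain ⟨r, hwr, hr⟩ := hwD x hx
  exact hr ((convex_ball _ _).segment_subset
    (Metric.mem_ball_self (Metric.pos_of_mem_ball hwr)) hwr hc)

lemma exists_continuousOn_eqOn_lipschitzNear {T V O : Set Y} (hT : IsOpen T) (hV : IsOpen V)
    (hTV : closure T ⊆ V) (hVO : closure V ⊆ O) {u : Y → E} (hu : ContinuousOn u O)
    {D : Set (Y × E)} (hD : IsOpen D) (huD : ∀ x ∈ O, (x, u x) ∈ D) :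
    ∃ v : Y → E, ContinuousOn v O ∧ EqOn v u Vᶜ ∧ (∀ x ∈ O, (x, v x) ∈ D) ∧
      ∀ y, y ∈ T ∨ LipschitzNear u y → LipschitzNear v y := by
  obtain ⟨w, hw, hwD⟩ := exists_locallyLipschitz_segment_subset isClosed_closure (hu.mono hVO)
    hD fun x hx => huD x (hVO hx)
  obtain ⟨χ, hχ, hχ0, hχ1, hχI⟩ := exists_locallyLipschitz_zero_one_of_isClosed
    hV.isClosed_compl isClosed_closure (disjoint_compl_left_iff_subset.2 hTV)
  let v : Y → E := fun x => (1 - χ x) • u x + χ x • w x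
  have hvu : EqOn v u Vᶜ := fun x hx => by
    have h0 : χ x = 0 := hχ0 hx
    simp only [v, h0, sub_zero, one_smul, zero_smul, add_zero]
  have hvw : EqOn v w T := fun x hx => by
    have h1 : χ x = 1 := hχ1 (subset_closure hx)
    simp only [v, h1, sub_self, zero_smul, one_smul, zero_add]
  refine ⟨v, ((continuousOn_const.sub χ.continuous.continuousOn).smul hu).add
    (χ.continuous.continuousOn.smul hw.continuous.continuousOn), hvu, fun x hx => ?_, ?_⟩
  · by_cases hxV : x ∈ V
    · exact hwD x (subset_closure hxV) _ ⟨1 - χ x, χ x, sub_nonneg.2 (hχI x).2, (hχI x).1,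
        sub_add_cancel _ _, rfl⟩
    · exact hvu hxV ▸ huD x hx
  · rintro y (hy | hy)
    · exact LipschitzNear.congr (hw y) (hvw.eventuallyEq_of_mem (hT.mem_nhds hy))
    · exact (LipschitzNear.one_sub (hχ y)).smul hy |>.add (.smul (hχ y) (hw y))

end LocallyLipschitz

section LocallyFiniteFamilies

variable {Y Z ι : Type*} [TopologicalSpace Y]

lemma exists_locallyFinite_closure_subset_closure_subset [NormalSpace Y] [ParacompactSpace Y]
    {U : ι → Set Y} (hU : ∀ i, IsOpen (U i)) (hcover : ⋃ i, U i = univ) :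
    ∃ T V : ι → Set Y, (∀ i, IsOpen (T i)) ∧ (∀ i, IsOpen (V i)) ∧ LocallyFinite V ∧
      ⋃ i, T i = univ ∧ (∀ i, closure (T i) ⊆ V i) ∧ ∀ i, closure (V i) ⊆ U i := by
  obtain ⟨U', hU', hcover', hfin, hsub⟩ := precise_refinement U hU hcover
  obtain ⟨V, hcoverV, hV, hVU⟩ := exists_iUnion_eq_closure_subset hU' hfin.point_finite hcover'
  have hfinV : LocallyFinite V := hfin.subset fun i => subset_closure.trans (hVU i)
  obtain ⟨T, hcoverT, hT, hTV⟩ := exists_iUnion_eq_closure_subset hV hfinV.point_finite hcoverV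
  exact ⟨T, V, hT, hV, hfinV, hcoverT, hTV, fun i => (hVU i).trans (hsub i)⟩

lemma isOpen_setOf_forall_mem_imp_mem [TopologicalSpace Z] {pr : Z → Y} (hpr : Continuous pr)
    {A : ι → Set Y} (hA : LocallyFinite A) (hAc : ∀ i, IsClosed (A i)) {S : ι → Set Z}
    (hS : ∀ i, IsOpen (S i)) : IsOpen {z | ∀ i, pr z ∈ A i → z ∈ S i} := by
  have hclosed : IsClosed (⋃ i, pr ⁻¹' A i ∩ (S i)ᶜ) :=
    ((hA.preimage_continuous hpr).subset fun i => inter_subset_left).isClosed_iUnion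
      fun i => ((hAc i).preimage hpr).inter (hS i).isClosed_compl
  convert hclosed.isOpen_compl using 1
  ext z
  simp

lemma exists_forall_eventually_eventuallyEq_of_locallyFinite {O : ℕ → Set Y}
    (hO : LocallyFinite O) {Q : ℕ → (Y → Z) → Prop} {s : Y → Z} (hs : Q 0 s)
    (hQ : ∀ n s, Q n s → ∃ s', Q (n + 1) s' ∧ EqOn s' s (O n)ᶜ) :
    ∃ F : Y → Z, ∀ x, ∀ᶠ n in atTop, ∃ s', Q n s' ∧ s' =ᶠ[𝓝 x] F := by
  choose! next hnext hEqOn using hQ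
  let σ : ℕ → Y → Z := fun n => Nat.rec s next n
  have hσ (n : ℕ) : Q n (σ n) := by
    induction n with
    | zero => exact hs
    | succ n ih => exact hnext n _ ih
  have hfin : LocallyFinite fun n => {x | σ (n + 1) x ≠ σ n x} :=
    hO.subset fun n x hx => of_not_not fun hxO => hx (hEqOn n _ (hσ n) hxO)
  obtain ⟨F, hF⟩ := hfin.exists_forall_eventually_atTop_eventuallyEq
  exact ⟨F, fun x => (hF x).mono fun n hn => ⟨σ n, hσ n, hn⟩⟩

end LocallyFiniteFamilies

section ContinuousSections

variable {Y Z F : Type*} [TopologicalSpace Y] [TopologicalSpace Z] [TopologicalSpace F]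

/-- The map `s` is a continuous section of `pr` with values in the set `W`. -/
structure IsSectionInto (pr : Z → Y) (W : Set Z) (s : Y → Z) : Prop where
  continuous : Continuous s
  proj_apply : ∀ x, pr (s x) = x
  mem : ∀ x, s x ∈ W

lemma IsSectionInto.chart_apply {pr : Z → Y} {W : Set Z} {s : Y → Z} (hs : IsSectionInto pr W s)
    {φ : OpenPartialHomeomorph Z (Y × F)} (hφ : ∀ z ∈ φ.source, (φ z).1 = pr z) {x : Y}
    (hx : s x ∈ φ.source) : φ (s x) = (x, (φ (s x)).2) :=
  Prod.ext ((hφ _ hx).trans (hs.proj_apply x)) rfl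

lemma IsSectionInto.exists_eqOn_compl_chart_eq {pr : Z → Y} {W : Set Z} {s : Y → Z}
    (hs : IsSectionInto pr W s) {φ : OpenPartialHomeomorph Z (Y × F)}
    (hφ : ∀ z ∈ φ.source, (φ z).1 = pr z) {V : Set Y} (hV : closure V ⊆ s ⁻¹' φ.source)
    {v : Y → F} (hv : ContinuousOn v (s ⁻¹' φ.source))
    (hvs : ∀ x ∈ s ⁻¹' φ.source \ V, v x = (φ (s x)).2)
    (hvW : ∀ x ∈ s ⁻¹' φ.source, (x, v x) ∈ φ.target ∩ φ.symm ⁻¹' W) :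
    ∃ s', IsSectionInto pr W s' ∧ EqOn s' s Vᶜ ∧
      ∀ x ∈ s ⁻¹' φ.source, s' x ∈ φ.source ∧ (φ (s' x)).2 = v x := by
  classical
  set O := s ⁻¹' φ.source
  have hO : IsOpen O := φ.open_source.preimage hs.continuous
  let s' : Y → Z := O.piecewise (fun x => φ.symm (x, v x)) s
  have hs' {x : Y} (hx : x ∈ O) : s' x = φ.symm (x, v x) := piecewise_eq_of_mem _ _ _ hx
  have hmem {x : Y} (hx : x ∈ O) : s' x ∈ φ.source := hs' hx ▸ φ.map_target (hvW x hx).1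
  have hφs' {x : Y} (hx : x ∈ O) : φ (s' x) = (x, v x) := hs' hx ▸ φ.right_inv (hvW x hx).1
  have heq : EqOn s' s Vᶜ := fun x hx => by
    by_cases hxO : x ∈ O
    · rw [hs' hxO, hvs x ⟨hxO, hx⟩, ← hs.chart_apply hφ hxO, φ.left_inv hxO]
    · exact piecewise_eq_of_notMem _ _ _ hxO
  have hcont : Continuous s' := by
    have h1 : ContinuousOn s' O := (φ.continuousOn_symm.comp (continuousOn_id.prodMk hv)
      fun x hx => (hvW x hx).1).congr fun x hx => hs' hx
    have h2 : ContinuousOn s' (closure V)ᶜ :=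
      hs.continuous.continuousOn.congr (heq.mono (compl_subset_compl.2 subset_closure))
    refine continuousOn_univ.1 ((h1.union_of_isOpen h2 hO isClosed_closure.isOpen_compl).mono ?_)
    exact fun x _ => or_iff_not_imp_right.2 fun hx => hV (not_not.1 hx)
  refine ⟨s', ⟨hcont, fun x => ?_, fun x => ?_⟩, heq, fun x hx => ⟨hmem hx, by rw [hφs' hx]⟩⟩
  · by_cases hx : x ∈ O
    · rw [← hφ _ (hmem hx), hφs' hx]
    · rw [heq fun hxV => hx (hV (subset_closure hxV)), hs.proj_apply]
  · by_cases hx : x ∈ O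
    · exact hs' hx ▸ (hvW x hx).2
    · exact heq (fun hxV => hx (hV (subset_closure hxV))) ▸ hs.mem x

end ContinuousSections

section LipschitzSections

variable {Y Z E ι : Type*} [PseudoMetricSpace Y] [TopologicalSpace Z] [NormedAddCommGroup E]

/-- The charts `Φ i` of `Z`, with values in `Y × E` and compatible with `pr : Z → Y`, make `Z` a
Lipschitz bundle over `Y`: they cover `Z` and the changes of charts are locally Lipschitz. -/
structure IsLipschitzAtlas (pr : Z → Y) (Φ : ι → OpenPartialHomeomorph Z (Y × E)) : Prop where
  continuous_proj : Continuous pr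
  fst_eq : ∀ i, ∀ z ∈ (Φ i).source, (Φ i z).1 = pr z
  cover : ∀ z, ∃ i, z ∈ (Φ i).source
  lipschitzNear_change : ∀ i j, ∀ z ∈ (Φ i).source, z ∈ (Φ j).source →
    LipschitzNear (fun q => (Φ j ((Φ i).symm q)).2) (Φ i z)

/-- The section `s` of a Lipschitz bundle is locally Lipschitz at `y`, in every chart at `s y`. -/
def LipschitzSectionAt (Φ : ι → OpenPartialHomeomorph Z (Y × E)) (s : Y → Z) (y : Y) : Prop :=
  ∀ j, s y ∈ (Φ j).source → LipschitzNear (fun x => (Φ j (s x)).2) y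

variable {pr : Z → Y} {Φ : ι → OpenPartialHomeomorph Z (Y × E)} {W : Set Z} {s : Y → Z} {y : Y}

lemma LipschitzSectionAt.congr {s' : Y → Z} (hs : LipschitzSectionAt Φ s y) (h : s' =ᶠ[𝓝 y] s) :
    LipschitzSectionAt Φ s' y := fun j hj =>
  (hs j (h.eq_of_nhds ▸ hj)).congr (h.fun_comp fun z => (Φ j z).2)

namespace IsLipschitzAtlas

lemma lipschitzSectionAt_of_chart (h : IsLipschitzAtlas pr Φ) (hs : IsSectionInto pr W s) {i : ι}
    (hi : s y ∈ (Φ i).source) (hl : LipschitzNear (fun x => (Φ i (s x)).2) y) :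
    LipschitzSectionAt Φ s y := by
  intro j hj
  have hchange := h.lipschitzNear_change i j _ hi hj
  rw [hs.chart_apply (h.fst_eq i) hi] at hchange
  refine (hchange.comp (u := fun x => (x, (Φ i (s x)).2))
    (LipschitzNear.prodMk (LocallyLipschitz.id y) hl)).congr ?_
  filter_upwards [hs.continuous.continuousAt ((Φ i).open_source.mem_nhds hi)] with x hx
  rw [← hs.chart_apply (h.fst_eq i) hx, (Φ i).left_inv hx]

variable [NormedSpace ℝ E]

lemma exists_lipschitzSectionAt_of_mem (h : IsLipschitzAtlas pr Φ) (hW : IsOpen W)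
    (hs : IsSectionInto pr W s) {i : ι} {T V : Set Y} (hT : IsOpen T) (hV : IsOpen V)
    (hTV : closure T ⊆ V) (hVs : closure V ⊆ s ⁻¹' (Φ i).source) :
    ∃ s', IsSectionInto pr W s' ∧ EqOn s' s Vᶜ ∧
      ∀ y, y ∈ T ∨ LipschitzSectionAt Φ s y → LipschitzSectionAt Φ s' y := by
  set O := s ⁻¹' (Φ i).source
  let u : Y → E := fun x => (Φ i (s x)).2
  have hu : ContinuousOn u O := continuous_snd.comp_continuousOn
    ((Φ i).continuousOn.comp hs.continuous.continuousOn fun _ hx => hx)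
  have huW : ∀ x ∈ O, (x, u x) ∈ (Φ i).target ∩ (Φ i).symm ⁻¹' W := fun x hx => by
    rw [← hs.chart_apply (h.fst_eq i) hx]
    exact ⟨(Φ i).map_source hx, by simpa only [mem_preimage, (Φ i).left_inv hx] using hs.mem x⟩
  obtain ⟨v, hv, hvu, hvW, hvl⟩ := exists_continuousOn_eqOn_lipschitzNear hT hV hTV hVs hu
    ((Φ i).isOpen_inter_preimage_symm hW) huW
  obtain ⟨s', hs', hEqOn, hs'v⟩ := hs.exists_eqOn_compl_chart_eq (h.fst_eq i) hVs hv
    (fun x hx => hvu hx.2) hvW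
  refine ⟨s', hs', hEqOn, fun y hy => ?_⟩
  by_cases hyO : y ∈ O
  · have hvy : LipschitzNear v y := hvl y (hy.imp_right fun hy => hy i hyO)
    refine h.lipschitzSectionAt_of_chart hs' (hs'v y hyO).1 (hvy.congr ?_)
    filter_upwards [(Φ i).open_source.preimage hs.continuous |>.mem_nhds hyO] with x hx
    exact (hs'v x hx).2
  · have hyV : y ∉ closure V := fun h => hyO (hVs h)
    refine (hy.resolve_left fun hyT =>
      hyV (subset_closure (hTV (subset_closure hyT)))).congr ?_
    filter_upwards [isClosed_closure.isOpen_compl.mem_nhds hyV] with x hx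
    exact hEqOn fun hxV => hx (subset_closure hxV)

theorem exists_isSectionInto_lipschitzSectionAt [LindelofSpace Y] (h : IsLipschitzAtlas pr Φ)
    (hW : IsOpen W) (hs : IsSectionInto pr W s) :
    ∃ s', IsSectionInto pr W s' ∧ ∀ y, LipschitzSectionAt Φ s' y := by
  rcases isEmpty_or_nonempty ι with hι | hι
  · exact ⟨s, hs, fun _ j => isEmptyElim j⟩
  have hO (i : ι) : IsOpen (s ⁻¹' (Φ i).source) := (Φ i).open_source.preimage hs.continuous
  obtain ⟨i, hi⟩ := isLindelof_univ.indexed_countable_subcover _ hO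
    fun y _ => mem_iUnion.2 (h.cover (s y))
  obtain ⟨T, V, hT, hV, hfin, hcover, hTV, hVs⟩ :=
    exists_locallyFinite_closure_subset_closure_subset (fun n => hO (i n)) (univ_subset_iff.1 hi)
  -- Staying in `W'`, every modification of `s` still has values in the chart `i n` over `V n`.
  let W' : Set Z := W ∩ {z | ∀ n, pr z ∈ closure (V n) → z ∈ (Φ (i n)).source}
  have hW' : IsOpen W' := hW.inter (isOpen_setOf_forall_mem_imp_mem h.continuous_proj hfin.closure
    (fun _ => isClosed_closure) fun n => (Φ (i n)).open_source)
  obtain ⟨F, hF⟩ := exists_forall_eventually_eventuallyEq_of_locallyFinite hfin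
    (Q := fun n s => IsSectionInto pr W' s ∧ ∀ k < n, ∀ y ∈ T k, LipschitzSectionAt Φ s y)
    (s := s) ⟨⟨hs.continuous, hs.proj_apply, fun x => ⟨hs.mem x, fun n hn =>
      hVs n (hs.proj_apply x ▸ hn)⟩⟩, fun k hk => absurd hk k.not_lt_zero⟩
    fun n s ⟨hs, hl⟩ => by
      obtain ⟨s', hs', hEqOn, hl'⟩ := h.exists_lipschitzSectionAt_of_mem hW' hs (hT n) (hV n)
        (hTV n) fun x hx => (hs.mem x).2 n (by rwa [hs.proj_apply])
      refine ⟨s', ⟨hs', fun k hk y hy => hl' y ?_⟩, hEqOn⟩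
      rcases Nat.lt_succ_iff_lt_or_eq.1 hk with hk | rfl
      exacts [.inr (hl k hk y hy), .inl hy]
  refine ⟨F, ⟨continuous_iff_continuousAt.2 fun x => ?_, fun x => ?_, fun x => ?_⟩, fun y => ?_⟩
  · obtain ⟨n, s', ⟨hs', -⟩, hF'⟩ := (hF x).exists
    exact hs'.continuous.continuousAt.congr hF'
  · obtain ⟨n, s', ⟨hs', -⟩, hF'⟩ := (hF x).exists
    exact hF'.eq_of_nhds ▸ hs'.proj_apply x
  · obtain ⟨n, s', ⟨hs', -⟩, hF'⟩ := (hF x).exists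
    exact hF'.eq_of_nhds ▸ (hs'.mem x).1
  · obtain ⟨k, hk⟩ := mem_iUnion.1 (hcover.symm ▸ mem_univ y : y ∈ ⋃ n, T n)
    obtain ⟨n, ⟨s', ⟨-, hl⟩, hF'⟩, hkn⟩ := ((hF y).and (eventually_gt_atTop k)).exists
    exact (hl k hkn y hk).congr hF'.symm

end IsLipschitzAtlas

end LipschitzSections

section TimeOneMap

variable {E : Type*} [NormedAddCommGroup E] [NormedSpace ℝ E]

lemma exists_hasDerivAt_mem_closedBall_of_isPicardLindelof [CompleteSpace E] {f : ℝ → E → E}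
    {tmin tmax : ℝ} {t₀ : Icc tmin tmax} {x₀ x : E} {a r L K : ℝ≥0}
    (hf : IsPicardLindelof f t₀ x₀ a r L K) (hx : x ∈ Metric.closedBall x₀ r) :
    ∃ α : ℝ → E, α t₀ = x ∧ ∀ t ∈ Ioo tmin tmax,
      HasDerivAt α (f t (α t)) t ∧ α t ∈ Metric.closedBall x₀ a := by
  obtain ⟨α, hα⟩ := ODE.FunSpace.exists_isFixedPt_next hf hx
  have hmem (t : ℝ) : α.compProj t ∈ Metric.closedBall x₀ a :=
    α.compProj_mem_closedBall hf.mul_max_le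
  have hpicard (t : ℝ) (ht : t ∈ Icc tmin tmax) :
      α.compProj t = ODE.picard f t₀ x α.compProj t := by
    nth_rw 1 [← hα]
    rw [ODE.FunSpace.compProj_of_mem ht, ODE.FunSpace.next_apply]
  refine ⟨α.compProj, ?_, fun t ht => ⟨?_, hmem t⟩⟩
  · rw [hpicard t₀ t₀.2, ODE.picard_apply₀]
  · have hderiv := ODE.hasDerivWithinAt_picard_Icc t₀.2 hf.continuousOn_uncurry
      α.continuous_compProj.continuousOn (fun _ _ => hmem _) x (Ioo_subset_Icc_self ht)
    exact (hderiv.congr_of_mem hpicard (Ioo_subset_Icc_self ht)).hasDerivAt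
      (Icc_mem_nhds ht.1 ht.2)

variable {F : Type*} [NormedAddCommGroup F] [NormedSpace ℝ F] {A : E → F →L[ℝ] E} {y₀ : E}
  {K : ℝ≥0} {s : Set E}

lemma exists_hasDerivAt_apply_mem_closedBall [CompleteSpace E] {M : ℝ≥0} {ρ : ℝ}
    (hK : LipschitzOnWith K A (Metric.ball y₀ ρ)) (hM : ∀ y ∈ Metric.ball y₀ ρ, ‖A y‖ ≤ M) {v : F}
    (hv : 2 * M * ‖v‖ < ρ) :
    ∃ c : ℝ → E, c 0 = y₀ ∧ ∀ t ∈ Ioo (-2 : ℝ) 2,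
      HasDerivAt c (A (c t) v) t ∧ c t ∈ Metric.closedBall y₀ (2 * M * ‖v‖) := by
  have hsub : Metric.closedBall y₀ (2 * M * ‖v‖₊ : ℝ≥0) ⊆ Metric.ball y₀ ρ :=
    Metric.closedBall_subset_ball (by exact_mod_cast hv)
  have hPL : IsPicardLindelof (fun _ y => A y v) (tmin := -2) (tmax := 2)
      ⟨0, by norm_num⟩ y₀ (2 * M * ‖v‖₊) 0 (M * ‖v‖₊) (K * ‖v‖₊) := by
    refine IsPicardLindelof.of_time_independent (fun y hy => ?_) ?_ ?_
    · exact (A y).le_of_opNorm_le (hM y (hsub hy)) v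
    · refine LipschitzOnWith.of_dist_le_mul fun y hy z hz => ?_
      rw [dist_eq_norm, ← sub_apply]
      refine ((A y - A z).le_of_opNorm_le ?_ v).trans_eq (mul_right_comm _ _ _)
      rw [← dist_eq_norm]
      exact hK.dist_le_mul y (hsub hy) z (hsub hz)
    · norm_num
      linarith
  obtain ⟨c, hc0, hc⟩ := exists_hasDerivAt_mem_closedBall_of_isPicardLindelof hPL
    (Metric.mem_closedBall_self le_rfl)
  exact ⟨c, hc0, by exact_mod_cast hc⟩

lemma norm_apply_sub_apply_sub_le (hK : LipschitzOnWith K A s) {y z : E} (hy : y ∈ s) (hz : z ∈ s)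
    (hy₀ : y₀ ∈ s) (v w : F) {t : ℝ} (ht : t ∈ Icc (0 : ℝ) 1) :
    ‖A y v - A z w - A y₀ (v - w)‖ ≤ K * ‖v‖ * ‖y - z - t • A y₀ (v - w)‖ +
      K * (‖A y₀‖ * ‖v‖ + ‖z - y₀‖) * ‖v - w‖ := by
  have hsplit : A y v - A z w - A y₀ (v - w) = (A y - A z) v + (A z - A y₀) (v - w) := by
    simp only [sub_apply, map_sub]
    abel
  have hLip {a b : E} (ha : a ∈ s) (hb : b ∈ s) : ‖A a - A b‖ ≤ K * ‖a - b‖ := by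
    simpa only [dist_eq_norm] using hK.dist_le_mul a ha b hb
  have hyz : ‖y - z‖ ≤ ‖y - z - t • A y₀ (v - w)‖ + ‖A y₀‖ * ‖v - w‖ :=
    calc ‖y - z‖ = ‖y - z - t • A y₀ (v - w) + t • A y₀ (v - w)‖ := by rw [sub_add_cancel]
      _ ≤ ‖y - z - t • A y₀ (v - w)‖ + ‖t • A y₀ (v - w)‖ := norm_add_le _ _
      _ ≤ _ := by
        rw [norm_smul, Real.norm_of_nonneg ht.1]
        exact add_le_add_right ((mul_le_of_le_one_left (norm_nonneg _) ht.2).trans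
          ((A y₀).le_opNorm (v - w))) _
  calc _ ≤ K * ‖y - z‖ * ‖v‖ + K * ‖z - y₀‖ * ‖v - w‖ := by
        rw [hsplit]
        exact (norm_add_le _ _).trans (add_le_add ((A y - A z).le_of_opNorm_le (hLip hy hz) v)
          ((A z - A y₀).le_of_opNorm_le (hLip hz hy₀) (v - w)))
    _ ≤ K * (‖y - z - t • A y₀ (v - w)‖ + ‖A y₀‖ * ‖v - w‖) * ‖v‖ +
        K * ‖z - y₀‖ * ‖v - w‖ := by gcongr
    _ = _ := by ring

lemma norm_sub_sub_le_of_hasDerivAt_apply (hK : LipschitzOnWith K A s) (hy₀ : y₀ ∈ s) {v w : F}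
    (hKv : K * ‖v‖ ≤ 1) {c d : ℝ → E} (hc0 : c 0 = y₀) (hd0 : d 0 = y₀)
    (hc : ∀ t ∈ Icc (0 : ℝ) 1, HasDerivAt c (A (c t) v) t ∧ c t ∈ s)
    (hd : ∀ t ∈ Icc (0 : ℝ) 1, HasDerivAt d (A (d t) w) t ∧ d t ∈ s) {R : ℝ}
    (hdR : ∀ t ∈ Icc (0 : ℝ) 1, ‖d t - y₀‖ ≤ R) :
    ‖c 1 - d 1 - A y₀ (v - w)‖ ≤ 2 * (K * (‖A y₀‖ * ‖v‖ + R) * ‖v - w‖) := by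
  let err : ℝ → E := fun t => c t - d t - t • A y₀ (v - w)
  have hderiv : ∀ t ∈ Icc (0 : ℝ) 1,
      HasDerivAt err (A (c t) v - A (d t) w - A y₀ (v - w)) t := fun t ht => by
    have h := ((hc t ht).1.sub (hd t ht).1).sub ((hasDerivAt_id t).smul_const (A y₀ (v - w)))
    rwa [one_smul] at h
  have hbound : ∀ t ∈ Icc (0 : ℝ) 1, ‖A (c t) v - A (d t) w - A y₀ (v - w)‖ ≤
      1 * ‖err t‖ + K * (‖A y₀‖ * ‖v‖ + R) * ‖v - w‖ := fun t ht =>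
    (norm_apply_sub_apply_sub_le hK (hc t ht).2 (hd t ht).2 hy₀ v w ht).trans <| by
      gcongr
      exact hdR t ht
  have hgronwall := norm_le_gronwallBound_of_norm_deriv_right_le (δ := 0)
    (fun t ht => (hderiv t ht).continuousAt.continuousWithinAt)
    (fun t ht => (hderiv t (Ico_subset_Icc_self ht)).hasDerivWithinAt)
    (by simp [err, hc0, hd0]) (fun t ht => hbound t (Ico_subset_Icc_self ht)) 1 (by norm_num)
  have hR : 0 ≤ R := (norm_nonneg _).trans (hdR 0 (by norm_num))
  have hexp : Real.exp 1 - 1 ≤ 2 := by linarith [Real.exp_one_lt_d9]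
  simp only [gronwallBound_of_K_ne_0 one_ne_zero, err, one_smul, sub_zero, mul_one, zero_mul,
    zero_add, div_one] at hgronwall
  calc _ ≤ K * (‖A y₀‖ * ‖v‖ + R) * ‖v - w‖ * (Real.exp 1 - 1) := hgronwall
    _ ≤ K * (‖A y₀‖ * ‖v‖ + R) * ‖v - w‖ * 2 := by gcongr
    _ = _ := mul_comm _ _

lemma exists_hasDerivAt_apply_hasStrictFDerivAt [CompleteSpace E] (hA : LipschitzNear A y₀)
    {U : Set E} (hU : U ∈ 𝓝 y₀) :
    ∃ c : F → ℝ → E, (∀ᶠ v in 𝓝 0, c v 0 = y₀ ∧ ∀ t ∈ Ioo (-2 : ℝ) 2,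
        HasDerivAt (c v) (A (c v t) v) t ∧ c v t ∈ U) ∧
      HasStrictFDerivAt (fun v => c v 1) (A y₀) 0 := by
  obtain ⟨K, M, ρ, hρ, hρU, hK, hM⟩ := hA.exists_lipschitzOnWith_ball_norm_le hU
  choose! c hc0 hc using fun v (hv : 2 * M * ‖v‖ < ρ) =>
    exists_hasDerivAt_apply_mem_closedBall hK hM hv
  have hmem (v : F) (hv : 2 * M * ‖v‖ < ρ) (t : ℝ) (ht : t ∈ Ioo (-2 : ℝ) 2) :
      c v t ∈ Metric.ball y₀ ρ := Metric.closedBall_subset_ball hv (hc v hv t ht).2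
  have hsmall : ∀ᶠ v in 𝓝 (0 : F), 2 * M * ‖v‖ < ρ ∧ K * ‖v‖ ≤ 1 :=
    (((by fun_prop : Continuous fun v : F => 2 * M * ‖v‖).tendsto' 0 0
      (by simp)).eventually_lt_const hρ).and
    (((by fun_prop : Continuous fun v : F => K * ‖v‖).tendsto' 0 0
      (by simp)).eventually_le_const one_pos)
  refine ⟨c, hsmall.mono fun v hv => ⟨hc0 v hv.1, fun t ht =>
    ⟨(hc v hv.1 t ht).1, hρU (hmem v hv.1 t ht)⟩⟩, ?_⟩
  refine .of_isLittleO (Asymptotics.isLittleO_iff.2 fun ε hε => ?_)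
  have hε' : ∀ᶠ p in 𝓝 ((0, 0) : F × F), 2 * (K * (‖A y₀‖ * ‖p.1‖ + 2 * M * ‖p.2‖)) < ε :=
    ((by fun_prop : Continuous fun p : F × F =>
      2 * (K * (‖A y₀‖ * ‖p.1‖ + 2 * M * ‖p.2‖))).tendsto' _ 0 (by simp)).eventually_lt_const hε
  filter_upwards [hε', (prod_mem_nhds hsmall hsmall : _ ∈ 𝓝 ((0, 0) : F × F))]
    with ⟨v, w⟩ hvw ⟨hv, hw⟩
  have hIcc (t : ℝ) (ht : t ∈ Icc (0 : ℝ) 1) : t ∈ Ioo (-2 : ℝ) 2 :=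
    ⟨by linarith [ht.1], by linarith [ht.2]⟩
  calc _ ≤ 2 * (K * (‖A y₀‖ * ‖v‖ + 2 * M * ‖w‖) * ‖v - w‖) :=
        norm_sub_sub_le_of_hasDerivAt_apply hK (Metric.mem_ball_self hρ) hv.2 (hc0 v hv.1)
          (hc0 w hw.1) (fun t ht => ⟨(hc v hv.1 t (hIcc t ht)).1, hmem v hv.1 t (hIcc t ht)⟩)
          (fun t ht => ⟨(hc w hw.1 t (hIcc t ht)).1, hmem w hw.1 t (hIcc t ht)⟩)
          fun t ht => mem_closedBall_iff_norm.1 (hc w hw.1 t (hIcc t ht)).2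
    _ = 2 * (K * (‖A y₀‖ * ‖v‖ + 2 * M * ‖w‖)) * ‖v - w‖ := by ring
    _ ≤ ε * ‖v - w‖ := by gcongr

end TimeOneMap

noncomputable section

section IntegralCurves

variable {E : Type*} [NormedAddCommGroup E] [NormedSpace ℝ E]
  {M : Type*} [TopologicalSpace M] [ChartedSpace E M]
  {E' : Type*} [NormedAddCommGroup E'] [NormedSpace ℝ E']
  {M' : Type*} [TopologicalSpace M'] [ChartedSpace E' M']

lemma isMIntegralCurveOn_comp {F : M → M'} {γ : ℝ → M} {s : Set ℝ}
    {V : ∀ x : M, TangentSpace 𝓘(ℝ, E) x} {W : ∀ x : M', TangentSpace 𝓘(ℝ, E') x}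
    (hγ : IsMIntegralCurveOn γ V s)
    (hF : ∀ t ∈ s, MDifferentiableAt 𝓘(ℝ, E) 𝓘(ℝ, E') F (γ t))
    (hVW : ∀ t ∈ s, mfderiv 𝓘(ℝ, E) 𝓘(ℝ, E') F (γ t) (V (γ t)) = W (F (γ t))) :
    IsMIntegralCurveOn (F ∘ γ) W s := by
  intro t ht
  refine ((hF t ht).hasMFDerivAt.comp_hasMFDerivWithinAt t (hγ t ht)).congr_mfderiv ?_
  refine ContinuousLinearMap.ext fun r : ℝ =>
    (map_smul (mfderiv 𝓘(ℝ, E) 𝓘(ℝ, E') F (γ t)) r (V (γ t))).trans ?_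
  rw [hVW t ht]
  rfl

end IntegralCurves

section LieGroups

variable {E : Type*} [NormedAddCommGroup E] [NormedSpace ℝ E]
  {G : Type*} [TopologicalSpace G] [ChartedSpace E G] [Group G]
  {E' : Type*} [NormedAddCommGroup E'] [NormedSpace ℝ E']
  {H : Type*} [TopologicalSpace H] [ChartedSpace E' H] [Group H]

variable (E G) in
lemma t2Space_of_lieGroup (n : WithTop ℕ∞) [LieGroup 𝓘(ℝ, E) n G] : T2Space G := by
  have : IsTopologicalGroup G := topologicalGroup_of_lieGroup 𝓘(ℝ, E) n
  have : T1Space G := ChartedSpace.t1Space E G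
  infer_instance

lemma mfderiv_mulInvariantVectorField [ContMDiffMul 𝓘(ℝ, E) 1 G] [ContMDiffMul 𝓘(ℝ, E') 1 H]
    {F φ : G → H} {a : G} (hF : MDifferentiableAt 𝓘(ℝ, E) 𝓘(ℝ, E') F a)
    (hφ : MDifferentiableAt 𝓘(ℝ, E) 𝓘(ℝ, E') φ 1) (hφ_one : φ 1 = 1)
    (hFφ : ∀ b, F (a * b) = F a * φ b) (v : GroupLieAlgebra 𝓘(ℝ, E) G) :
    mfderiv 𝓘(ℝ, E) 𝓘(ℝ, E') F a (mulInvariantVectorField v a) =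
      mulInvariantVectorField (mfderiv 𝓘(ℝ, E) 𝓘(ℝ, E') φ 1 v : E') (F a) := by
  have hcomp : F ∘ (a * ·) = (F a * ·) ∘ φ := funext hFφ
  have hleft := mfderiv_comp_apply_of_eq 1 hF (mdifferentiableAt_mul_left (I := 𝓘(ℝ, E)))
    (mul_one a) v
  have hright := mfderiv_comp_apply_of_eq 1 (mdifferentiableAt_mul_left (I := 𝓘(ℝ, E')) (a := F a))
    hφ hφ_one v
  rw [hcomp] at hleft
  exact hleft.symm.trans hright

variable [LieGroup 𝓘(ℝ, E) 3 G] [LieGroup 𝓘(ℝ, E') 3 H]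

lemma contMDiff_one_mulInvariantVectorField (v : GroupLieAlgebra 𝓘(ℝ, E) G) :
    ContMDiff 𝓘(ℝ, E) 𝓘(ℝ, E).tangent 1
      (fun g : G => (mulInvariantVectorField v g : TangentBundle 𝓘(ℝ, E) G)) := by
  have : LieGroup 𝓘(ℝ, E) (minSmoothness ℝ 3) G := by
    rwa [minSmoothness_of_isRCLikeNormedField]
  refine (contMDiff_mulInvariantVectorField v).of_le ?_
  rw [minSmoothness_of_isRCLikeNormedField]
  exact one_le_two

lemma exists_isMIntegralCurve_eqOn_of_isMIntegralCurveOn {v : GroupLieAlgebra 𝓘(ℝ, E) G}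
    {γ : ℝ → G} (h_zero : γ 0 = 1) {ε : ℝ} (hε : 0 < ε)
    (hγ : IsMIntegralCurveOn γ (mulInvariantVectorField v) (Ioo (-ε) ε)) :
    ∃ δ : ℝ → G, δ 0 = 1 ∧ IsMIntegralCurve δ (mulInvariantVectorField v) ∧
      EqOn δ γ (Ioo (-ε) ε) := by
  have := t2Space_of_lieGroup E G 3
  have : LieGroup 𝓘(ℝ, E) 1 G := .of_le (n := 3) (by norm_num)
  have translate : ∀ a : G, ∃ γ : ℝ → G, γ 0 = a ∧
      IsMIntegralCurveOn γ (mulInvariantVectorField v) (Ioo (-ε) ε) := fun a => by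
    refine ⟨(a * ·) ∘ γ, by simp [h_zero], isMIntegralCurveOn_comp hγ
      (fun t _ => mdifferentiableAt_mul_left) fun t _ => ?_⟩
    rw [mfderiv_mulInvariantVectorField mdifferentiableAt_mul_left mdifferentiableAt_id rfl
      fun b => (mul_assoc a _ b).symm, mfderiv_id]
    rfl
  obtain ⟨δ, hδ_zero, hδ⟩ := exists_isMIntegralCurve_of_isMIntegralCurveOn
    (contMDiff_one_mulInvariantVectorField v) hε translate 1
  exact ⟨δ, hδ_zero, hδ, isMIntegralCurveOn_Ioo_eqOn_of_contMDiff_boundaryless (t₀ := 0)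
    ⟨neg_lt_zero.2 hε, hε⟩ (contMDiff_one_mulInvariantVectorField v) (hδ.isMIntegralCurveOn _) hγ
    (hδ_zero.trans h_zero.symm)⟩

lemma exists_isMIntegralCurve_mulInvariantVectorField [CompleteSpace E]
    (v : GroupLieAlgebra 𝓘(ℝ, E) G) :
    ∃ γ : ℝ → G, γ 0 = 1 ∧ IsMIntegralCurve γ (mulInvariantVectorField v) := by
  obtain ⟨γ, h_zero, hγ⟩ := exists_isMIntegralCurveAt_of_contMDiffAt_boundaryless (t₀ := 0)
    (contMDiff_one_mulInvariantVectorField v).contMDiffAt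
  obtain ⟨ε, hε, hγε⟩ := isMIntegralCurveAt_iff'.1 hγ
  rw [Real.ball_eq_Ioo, zero_sub, zero_add] at hγε
  obtain ⟨δ, hδ_zero, hδ, -⟩ :=
    exists_isMIntegralCurve_eqOn_of_isMIntegralCurveOn h_zero hε hγε
  exact ⟨δ, hδ_zero, hδ⟩

lemma lieExp_eq_of_isMIntegralCurve {v : GroupLieAlgebra 𝓘(ℝ, E) G} {γ : ℝ → G}
    (h_zero : γ 0 = 1) (hγ : IsMIntegralCurve γ (mulInvariantVectorField v)) :
    lieExp v = γ 1 := by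
  have := t2Space_of_lieGroup E G 3
  obtain ⟨δ, hδ_zero, hδ, hδ_one⟩ := Classical.epsilon_spec
    (⟨γ 1, γ, h_zero, hγ, rfl⟩ : ∃ a : G, ∃ γ : ℝ → G, γ 0 = 1 ∧
      IsMIntegralCurve γ (mulInvariantVectorField v) ∧ γ 1 = a)
  rw [← isMIntegralCurve_Ioo_eq_of_contMDiff_boundaryless (t₀ := 0)
    (contMDiff_one_mulInvariantVectorField v) hδ hγ (hδ_zero.trans h_zero.symm)]
  exact hδ_one.symm

lemma lieExp_eq_of_isMIntegralCurveOn {v : GroupLieAlgebra 𝓘(ℝ, E) G} {γ : ℝ → G}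
    (h_zero : γ 0 = 1) {ε : ℝ} (hε : 1 < ε)
    (hγ : IsMIntegralCurveOn γ (mulInvariantVectorField v) (Ioo (-ε) ε)) : lieExp v = γ 1 := by
  obtain ⟨δ, hδ_zero, hδ, hδγ⟩ :=
    exists_isMIntegralCurve_eqOn_of_isMIntegralCurveOn h_zero (one_pos.trans hε) hγ
  rw [lieExp_eq_of_isMIntegralCurve hδ_zero hδ, hδγ ⟨by linarith, hε⟩]

lemma lieExp_mfderiv [CompleteSpace E] (φ : G →* H) (hφ : MDifferentiable 𝓘(ℝ, E) 𝓘(ℝ, E') φ)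
    (v : GroupLieAlgebra 𝓘(ℝ, E) G) :
    lieExp (E := E') (G := H) (mfderiv 𝓘(ℝ, E) 𝓘(ℝ, E') φ 1 v : E') = φ (lieExp v) := by
  have : LieGroup 𝓘(ℝ, E) 1 G := .of_le (n := 3) (by norm_num)
  have : LieGroup 𝓘(ℝ, E') 1 H := .of_le (n := 3) (by norm_num)
  obtain ⟨γ, h_zero, hγ⟩ := exists_isMIntegralCurve_mulInvariantVectorField v
  rw [lieExp_eq_of_isMIntegralCurve h_zero hγ]
  refine lieExp_eq_of_isMIntegralCurve (γ := φ ∘ γ) (by simp [h_zero]) ?_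
  rw [isMIntegralCurve_iff_isMIntegralCurveOn] at hγ ⊢
  exact isMIntegralCurveOn_comp hγ (fun t _ => hφ (γ t)) fun t _ =>
    mfderiv_mulInvariantVectorField (hφ (γ t)) (hφ 1) (map_one φ) (map_mul φ _) v

lemma lieExp_zero : lieExp (0 : GroupLieAlgebra 𝓘(ℝ, E) G) = (1 : G) :=
  lieExp_eq_of_isMIntegralCurve (γ := fun _ => 1) rfl
    (isMIntegralCurve_const (map_zero (mfderiv 𝓘(ℝ, E) 𝓘(ℝ, E) (fun b : G => 1 * b) 1)))

end LieGroups

section LieGroupExpChart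

variable {E : Type*} [NormedAddCommGroup E] [NormedSpace ℝ E]
  {G : Type*} [TopologicalSpace G] [ChartedSpace E G] [Group G]

variable (E G) in
/-- The multiplication of `G`, read in the chart at `1`. -/
def chartMul (y b : E) : E :=
  chartAt E (1 : G) ((chartAt E (1 : G)).symm y * (chartAt E (1 : G)).symm b)

variable (E G) in
/-- The left invariant vector fields, read in the chart at `1`: the one given by `v ∈ E = T₁ G` is
`y ↦ chartLeftInvariant E G y v`. -/
def chartLeftInvariant (y : E) : E →L[ℝ] E :=
  fderiv ℝ (chartMul E G y) (chartAt E (1 : G) 1)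

variable (E G) in
lemma chartLeftInvariant_chartAt_one :
    chartLeftInvariant E G (chartAt E (1 : G) 1) = ContinuousLinearMap.id ℝ E := by
  have h : chartMul E G (chartAt E (1 : G) 1) =ᶠ[𝓝 (chartAt E (1 : G) 1)] id := by
    filter_upwards [(chartAt E (1 : G)).open_target.mem_nhds (mem_chart_target E (1 : G))]
      with b hb
    simp [chartMul, hb]
  rw [chartLeftInvariant, h.fderiv_eq, fderiv_id]

lemma mfderiv_chart_symm_one [IsManifold 𝓘(ℝ, E) 1 G] :
    mfderiv 𝓘(ℝ, E) 𝓘(ℝ, E) (chartAt E (1 : G)).symm (chartAt E (1 : G) 1) =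
      ContinuousLinearMap.id ℝ E := by
  have h := mfderivWithin_range_extChartAt_symm (I := 𝓘(ℝ, E)) (x := (1 : G))
  simp only [mfld_simps, mfderivWithin_univ] at h
  exact h

lemma contDiffAt_chartMul (n : WithTop ℕ∞) [LieGroup 𝓘(ℝ, E) n G] {y b : E}
    (hy : y ∈ (chartAt E (1 : G)).target) (hb : b ∈ (chartAt E (1 : G)).target)
    (hyb : (chartAt E (1 : G)).symm y * (chartAt E (1 : G)).symm b ∈ (chartAt E (1 : G)).source) :
    ContDiffAt ℝ n (Function.uncurry (chartMul E G)) (y, b) := by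
  have hsymm : ∀ z ∈ (chartAt E (1 : G)).target,
      ContMDiffAt 𝓘(ℝ, E) 𝓘(ℝ, E) n (chartAt E (1 : G)).symm z := fun z hz =>
    contMDiffOn_chart_symm.contMDiffAt ((chartAt E (1 : G)).open_target.mem_nhds hz)
  have hmul : ContMDiffAt 𝓘(ℝ, E × E) 𝓘(ℝ, E) n
      (fun p : E × E => (chartAt E (1 : G)).symm p.1 * (chartAt E (1 : G)).symm p.2) (y, b) :=
    ((hsymm y hy).comp (y, b) contDiff_fst.contMDiff.contMDiffAt).mul
      ((hsymm b hb).comp (y, b) contDiff_snd.contMDiff.contMDiffAt)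
  rw [← contMDiffAt_iff_contDiffAt]
  exact ContMDiffAt.comp (y, b)
    (contMDiffOn_chart.contMDiffAt ((chartAt E (1 : G)).open_source.mem_nhds hyb)) hmul

variable (E G) in
lemma lipschitzNear_chartLeftInvariant [LieGroup 𝓘(ℝ, E) 2 G] :
    LipschitzNear (chartLeftInvariant E G) (chartAt E (1 : G) 1) := by
  have h := contDiffAt_chartMul 2 (mem_chart_target E (1 : G)) (mem_chart_target E (1 : G))
    (by simp)
  exact .of_contDiffAt (h.fderiv (g := fun _ => chartAt E (1 : G) 1) (m := 1) contDiffAt_const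
    one_add_one_eq_two.le)

lemma mfderiv_chart_symm_chartLeftInvariant [LieGroup 𝓘(ℝ, E) 1 G] {y : E}
    (hy : y ∈ (chartAt E (1 : G)).target) (v : E) :
    mfderiv 𝓘(ℝ, E) 𝓘(ℝ, E) (chartAt E (1 : G)).symm y (chartLeftInvariant E G y v) =
      mulInvariantVectorField (I := 𝓘(ℝ, E)) v ((chartAt E (1 : G)).symm y) := by
  have : IsTopologicalGroup G := topologicalGroup_of_lieGroup 𝓘(ℝ, E) 1
  set φ := chartAt E (1 : G)
  have hone : φ.symm (φ 1) = 1 := φ.left_inv (mem_chart_source E (1 : G))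
  have hmul_one : φ.symm y * φ.symm (φ 1) ∈ φ.source := by
    simpa only [hone, mul_one] using φ.map_target hy
  have hchartMul : chartMul E G y (φ 1) = y := by
    simp only [chartMul, φ, hone, mul_one, φ.right_inv hy]
  have hdiff : DifferentiableAt ℝ (chartMul E G y) (φ 1) :=
    ((contDiffAt_chartMul 1 hy (mem_chart_target E (1 : G)) hmul_one).comp (φ 1)
      (contDiffAt_const.prodMk contDiffAt_id)).differentiableAt one_ne_zero
  have hsymm : ∀ z ∈ φ.target, MDifferentiableAt 𝓘(ℝ, E) 𝓘(ℝ, E) φ.symm z := fun z hz =>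
    mdifferentiableAt_atlas_symm (chart_mem_atlas E (1 : G)) hz
  have hconj : φ.symm ∘ chartMul E G y =ᶠ[𝓝 (φ 1)] (φ.symm y * ·) ∘ φ.symm := by
    have hcont : ContinuousAt (fun b => φ.symm y * φ.symm b) (φ 1) :=
      continuousAt_const.mul (φ.continuousAt_symm (mem_chart_target E (1 : G)))
    filter_upwards [hcont (φ.open_source.mem_nhds hmul_one)] with b hb
    exact φ.left_inv hb
  have hleft := mfderiv_comp_apply_of_eq (φ 1) (hsymm y hy) hdiff.mdifferentiableAt hchartMul v
  have hright := mfderiv_comp_apply_of_eq (φ 1)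
    (mdifferentiableAt_mul_left (I := 𝓘(ℝ, E)) (a := φ.symm y))
    (hsymm _ (mem_chart_target E (1 : G))) hone v
  rw [hconj.mfderiv_eq] at hleft
  rw [mfderiv_eq_fderiv] at hleft
  rw [mfderiv_chart_symm_one] at hright
  exact hleft.symm.trans hright

theorem exists_openPartialHomeomorph_eqOn_lieExp [LieGroup 𝓘(ℝ, E) 3 G] [CompleteSpace E] :
    ∃ r > 0, ∃ Θ : OpenPartialHomeomorph E G, Θ.source = Metric.ball 0 r ∧
      ∀ v ∈ Metric.ball (0 : E) r, lieExp (E := E) (G := G) v = Θ v := by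
  have : LieGroup 𝓘(ℝ, E) 2 G := .of_le (n := 3) (by norm_num)
  set φ := chartAt E (1 : G)
  obtain ⟨c, hc, hderiv⟩ := exists_hasDerivAt_apply_hasStrictFDerivAt
    (lipschitzNear_chartLeftInvariant E G) (φ.open_target.mem_nhds (mem_chart_target E (1 : G)))
  have hexp : ∀ᶠ v in 𝓝 (0 : E), lieExp (E := E) (G := G) v = φ.symm (c v 1) := by
    filter_upwards [hc] with v ⟨hc_zero, hcv⟩
    refine lieExp_eq_of_isMIntegralCurveOn (γ := φ.symm ∘ c v) ?_ one_lt_two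
      (isMIntegralCurveOn_comp (V := fun y => chartLeftInvariant E G y v)
        (fun t ht => (hcv t ht).1.hasFDerivAt.hasMFDerivAt.hasMFDerivWithinAt)
        (fun t ht => mdifferentiableAt_atlas_symm (chart_mem_atlas E (1 : G)) (hcv t ht).2)
        fun t ht => mfderiv_chart_symm_chartLeftInvariant (hcv t ht).2 v)
    rw [Function.comp_apply, hc_zero]
    exact φ.left_inv (mem_chart_source E (1 : G))
  rw [chartLeftInvariant_chartAt_one] at hderiv
  have hderiv' : HasStrictFDerivAt (c · 1) (ContinuousLinearEquiv.refl ℝ E : E →L[ℝ] E) 0 :=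
    hderiv
  let Ψ := (hderiv'.toOpenPartialHomeomorph (c · 1)).trans φ.symm
  have hΨ : (0 : E) ∈ Ψ.source :=
    ⟨hderiv'.mem_toOpenPartialHomeomorph_source, (hc.self_of_nhds.2 1 (by norm_num)).2⟩
  obtain ⟨r, hr, hball⟩ := Metric.mem_nhds_iff.1
    (inter_mem (Ψ.open_source.mem_nhds hΨ) hexp)
  refine ⟨r, hr, Ψ.restrOpen (Metric.ball 0 r) Metric.isOpen_ball, ?_, fun v hv => (hball hv).2⟩
  rw [OpenPartialHomeomorph.restrOpen_source]
  exact inter_eq_right.2 fun v hv => (hball hv).1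

end LieGroupExpChart

section LocalHomeomorphisms

variable {A B Y ι : Type*} [TopologicalSpace A] [TopologicalSpace B]

lemma isOpenEmbedding_domRestrict_of_eqOn {f : A → B} {pr : A → Y} {pr' : B → Y}
    (hf : ∀ p, pr' (f p) = pr p) {Φ : ι → OpenPartialHomeomorph A B}
    (hΦ : ∀ i, EqOn f (Φ i) (Φ i).source) {T : ι → Set Y} (hT : ⋃ i, T i = univ) {N : Set A}
    (hN : IsOpen N) (hNΦ : ∀ p ∈ N, ∀ i, pr p ∈ T i → p ∈ (Φ i).source) :
    IsOpenEmbedding (N.domRestrict f) := by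
  have hlocal : IsLocalHomeomorphOn f N := .mk _ _ fun p hp => by
    obtain ⟨i, hi⟩ := iUnion_eq_univ_iff.1 hT (pr p)
    exact ⟨Φ i, hNΦ p hp i hi, hΦ i⟩
  have hinj : InjOn f N := fun p hp q hq hpq => by
    obtain ⟨i, hi⟩ := iUnion_eq_univ_iff.1 hT (pr p)
    have hpΦ := hNΦ p hp i hi
    have hqΦ := hNΦ q hq i (by rwa [← hf, ← hpq, hf])
    exact (Φ i).injOn hpΦ hqΦ (hΦ i hpΦ ▸ hΦ i hqΦ ▸ hpq)
  have hrestrict : IsLocalHomeomorph (f ∘ ((↑) : N → A)) :=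
    isLocalHomeomorph_iff_isLocalHomeomorphOn_univ.2
      (hlocal.comp hN.isOpenEmbedding_subtypeVal.isLocalHomeomorph.isLocalHomeomorphOn
        fun p _ => p.2)
  exact hrestrict.isOpenEmbedding_of_injective hinj.injective

end LocalHomeomorphisms

section Trivializations

variable {B G : Type*} [TopologicalSpace B] [TopologicalSpace G] {F : B → Type*}
  [TopologicalSpace (TotalSpace G F)] (e : Trivialization G (π G F)) {x : B}

lemma trivialization_symm_mk_snd (hx : x ∈ e.baseSet) (b : F x) :
    e.toOpenPartialHomeomorph.symm (x, (e ⟨x, b⟩).2) = ⟨x, b⟩ :=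
  e.symm_apply_mk_proj (x := ⟨x, b⟩) (e.mem_source.2 hx)

lemma bijective_trivialization_snd (hx : x ∈ e.baseSet) :
    Function.Bijective fun b : F x => (e ⟨x, b⟩).2 := by
  refine ⟨fun b c (hbc : (e ⟨x, b⟩).2 = (e ⟨x, c⟩).2) => TotalSpace.mk_injective (F := G) x ?_,
    fun a => ?_⟩
  · rw [← trivialization_symm_mk_snd e hx b, hbc, trivialization_symm_mk_snd e hx]
  · obtain ⟨⟨y, b⟩, hy, hb⟩ : ∃ z : TotalSpace G F, z.1 = x ∧ e z = (x, a) :=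
      ⟨_, e.proj_symm_apply' hx, e.apply_symm_apply' hx⟩
    obtain rfl : y = x := hy
    exact ⟨b, congrArg Prod.snd hb⟩

variable {S : Type*} [TopologicalSpace S] {u : S → B} {s : ∀ t, F (u t)} {t₀ : S}

lemma continuousAt_snd_trivialization (ht : u t₀ ∈ e.baseSet)
    (hs : ContinuousAt (fun t => (⟨u t, s t⟩ : TotalSpace G F)) t₀) :
    ContinuousAt (fun t => (e ⟨u t, s t⟩).2) t₀ :=
  continuous_snd.continuousAt.comp ((e.continuousAt (e.mem_source.2 ht)).comp
    (f := fun t => (⟨u t, s t⟩ : TotalSpace G F)) hs)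

lemma continuousAt_totalSpace_mk (hu : ContinuousAt u t₀) (ht : u t₀ ∈ e.baseSet)
    (hs : ContinuousAt (fun t => (e ⟨u t, s t⟩).2) t₀) :
    ContinuousAt (fun t => (⟨u t, s t⟩ : TotalSpace G F)) t₀ := by
  refine e.continuousAt_of_comp_left hu ht ((hu.prodMk hs).congr ?_)
  filter_upwards [hu (e.open_baseSet.mem_nhds ht)] with t ht
  exact Prod.ext (e.coe_fst' (show (⟨u t, s t⟩ : TotalSpace G F).1 ∈ e.baseSet from ht)).symm rfl

end Trivializations

section LieGroupBundles

variable {X : Type*} [NormedAddCommGroup X] [NormedSpace ℝ X] {Ω : Opens X}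
  {E : Type*} [NormedAddCommGroup E] [NormedSpace ℝ E]
  {G : Type*} [TopologicalSpace G] [ChartedSpace E G] [Group G]
  {Γ : Ω → Type*} [TopologicalSpace (TotalSpace G Γ)] [∀ x, TopologicalSpace (Γ x)]
  [∀ x, Group (Γ x)] [FiberBundle G Γ]

variable (E) in
/-- The group isomorphism `Γ x ≃ G` given by a trivialization of the Lie group bundle `Γ`. -/
def fiberMulEquiv (n : WithTop ℕ∞) [IsLieGroupBundle Ω E G n Γ] {e : Trivialization G (π G Γ)}
    (he : e ∈ FiberBundle.trivializationAtlas G Γ) {x : Ω} (hx : x ∈ e.baseSet) : Γ x ≃* G :=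
  MulEquiv.ofBijective
    (MonoidHom.mk' (fun a => (e ⟨x, a⟩).2)
      (IsLieGroupBundle.map_mul (Ω := Ω) (E := E) (n := n) e he x hx))
    (bijective_trivialization_snd e hx)

lemma fiberCoordChange_eq_fiberMulEquiv {n : WithTop ℕ∞} [IsLieGroupBundle Ω E G n Γ]
    {e e' : Trivialization G (π G Γ)} (he : e ∈ FiberBundle.trivializationAtlas G Γ)
    (he' : e' ∈ FiberBundle.trivializationAtlas G Γ) {x : Ω} (hx : x ∈ e.baseSet)
    (hx' : x ∈ e'.baseSet) :
    fiberCoordChange e e' x = fiberMulEquiv E n he' hx' ∘ (fiberMulEquiv E n he hx).symm := by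
  funext a
  obtain ⟨b, rfl⟩ := (fiberMulEquiv E n he hx).surjective a
  rw [Function.comp_apply, MulEquiv.symm_apply_apply]
  exact congrArg (fun z => (e' z).2) (trivialization_symm_mk_snd e hx b)

variable [IsLieGroupBundle Ω E G 3 Γ] [LieGroup 𝓘(ℝ, E) 3 G]

lemma fiberExp_eq_fiberMulEquiv_symm (x : Ω) (v : LieFiber E G Γ x) :
    fiberExp E G Γ x v = (fiberMulEquiv E 3 (FiberBundle.trivialization_mem_atlas G Γ x)
      (FiberBundle.mem_baseSet_trivializationAt G Γ x)).symm (lieExp (E := E) (G := G) v) := by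
  rw [MulEquiv.eq_symm_apply]
  exact Function.rightInverse_invFun (bijective_trivialization_snd _
    (FiberBundle.mem_baseSet_trivializationAt G Γ x)).2 (lieExp (E := E) (G := G) v)

variable (E G Γ) in
lemma fiberExp_zero (x : Ω) : fiberExp E G Γ x 0 = 1 := by
  rw [fiberExp_eq_fiberMulEquiv_symm, MulEquiv.symm_apply_eq, map_one]
  exact lieExp_zero

variable [CompleteSpace E]

lemma trivialization_bundleExp {e : Trivialization G (π G Γ)}
    (he : e ∈ FiberBundle.trivializationAtlas G Γ) {p : TotalSpace E (LieFiber E G Γ)}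
    (hp : p.1 ∈ e.baseSet) :
    e (bundleExp E G Γ p) =
      (p.1, lieExp (E := E) (G := G) ((lieAlgebraBundle E G Γ).localTriv ⟨e, he⟩ p).2) := by
  obtain ⟨x, v⟩ := p
  have hτ := FiberBundle.trivialization_mem_atlas G Γ x
  have hxτ := FiberBundle.mem_baseSet_trivializationAt G Γ x
  let φ : G →* G := (fiberMulEquiv E 3 hτ hxτ).symm.trans (fiberMulEquiv E 3 he hp)
  have hφ : ⇑φ = fiberCoordChange (FiberBundle.trivializationAt G Γ x) e x :=
    (fiberCoordChange_eq_fiberMulEquiv hτ he hxτ hp).symm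
  have hexp := lieExp_mfderiv (E := E) (E' := E) φ
    (hφ ▸ fun a => mdifferentiableAt_fiberCoordChange hτ he ⟨hxτ, hp⟩ a) (v : E)
  rw [hφ] at hexp
  refine Prod.ext (e.coe_fst' hp) (Eq.trans ?_ hexp.symm)
  rw [← hφ]
  exact congrArg (fiberMulEquiv E 3 he hp) (fiberExp_eq_fiberMulEquiv_symm x v)

lemma exists_openPartialHomeomorph_eqOn_bundleExp {Θ : OpenPartialHomeomorph E G}
    (hΘ : ∀ v ∈ Θ.source, lieExp (E := E) (G := G) v = Θ v) {e : Trivialization G (π G Γ)}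
    (he : e ∈ FiberBundle.trivializationAtlas G Γ) :
    ∃ B : OpenPartialHomeomorph (TotalSpace E (LieFiber E G Γ)) (TotalSpace G Γ),
      B.source = {p | p.1 ∈ e.baseSet ∧
        ((lieAlgebraBundle E G Γ).localTriv ⟨e, he⟩ p).2 ∈ Θ.source} ∧
      EqOn (bundleExp E G Γ) B B.source := by
  let L := (lieAlgebraBundle E G Γ).localTriv ⟨e, he⟩
  let B := (L.toOpenPartialHomeomorph.trans ((OpenPartialHomeomorph.refl Ω).prod Θ)).trans
    e.toOpenPartialHomeomorph.symm
  have hB : B.source = {p | p.1 ∈ e.baseSet ∧ (L p).2 ∈ Θ.source} := by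
    ext p
    exact ⟨fun h => ⟨L.mem_source.1 h.1.1, h.1.2.2⟩,
      fun h => ⟨⟨L.mem_source.2 h.1, mem_univ _, h.2⟩, e.mem_target.2 h.1⟩⟩
  refine ⟨B, hB, fun p hp => ?_⟩
  rw [hB] at hp
  rw [← e.symm_apply_apply (e.mem_source.2 (show (bundleExp E G Γ p).1 ∈ _ from hp.1)),
    trivialization_bundleExp he hp.1, hΘ _ hp.2]
  rfl

variable (E G Γ) in
theorem exists_isNormalNeighborhood_starConvex :
    ∃ N, IsNormalNeighborhood E G Γ N ∧ ∀ x, StarConvex ℝ 0 (fiberPart N x) := by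
  obtain ⟨r, hr, Θ, hΘ, hexp⟩ := exists_openPartialHomeomorph_eqOn_lieExp (E := E) (G := G)
  have he : ∀ x, FiberBundle.trivializationAt G Γ x ∈ FiberBundle.trivializationAtlas G Γ :=
    FiberBundle.trivialization_mem_atlas G Γ
  choose B hB hBexp using fun x => exists_openPartialHomeomorph_eqOn_bundleExp
    (fun v hv => hexp v (hΘ ▸ hv)) (he x)
  obtain ⟨T, V, -, -, hV, hcover, hTV, hVbase⟩ := exists_locallyFinite_closure_subset_closure_subset
    (fun x => (FiberBundle.trivializationAt G Γ x).open_baseSet)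
    (iUnion_eq_univ_iff.2 fun x => ⟨x, FiberBundle.mem_baseSet_trivializationAt G Γ x⟩)
  have hproj : Continuous fun p : TotalSpace E (LieFiber E G Γ) => p.1 :=
    FiberBundle.continuous_proj E (LieFiber E G Γ)
  let N : Set (TotalSpace E (LieFiber E G Γ)) := {p | ∀ i, p.1 ∈ closure (T i) → p ∈ (B i).source}
  have hN : IsOpen N := isOpen_setOf_forall_mem_imp_mem hproj (hV.subset hTV)
    (fun _ => isClosed_closure) fun i => (B i).open_source
  have hmem : ∀ x (v : E), v ∈ fiberPart N x ↔ ∀ i, x ∈ closure (T i) →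
      lieCoordChange E (FiberBundle.trivializationAt G Γ x) (FiberBundle.trivializationAt G Γ i) x v
        ∈ Metric.ball (0 : E) r := fun x v => by
    simp only [fiberPart, N, hB, hΘ]
    exact forall₂_congr fun i hi => and_iff_right (hVbase i (subset_closure (hTV i hi)))
  refine ⟨N, ⟨hN, fun x => (hmem x (0 : E)).2 fun i _ => ?_,
    isOpenEmbedding_domRestrict_of_eqOn (pr' := fun z => z.1) (fun _ => rfl) hBexp hcover hN
      fun p hp i hi => hp i (subset_closure hi)⟩, fun x => ?_⟩
  · rw [map_zero]
    exact Metric.mem_ball_self hr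
  · rw [starConvex_zero_iff]
    intro (v : E) hv t ht₀ ht₁
    refine (hmem x (t • v)).2 fun i hi => ?_
    rw [map_smul]
    exact ((convex_ball (0 : E) r).starConvex (Metric.mem_ball_self hr)).smul_mem
      ((hmem x v).1 hv i hi) ht₀ ht₁

end LieGroupBundles

section TotalSpaceCharts

variable {B E G : Type*} [TopologicalSpace B] [NormedAddCommGroup E] [TopologicalSpace G]
  [ChartedSpace E G] {P : B → Type*} [TopologicalSpace (TotalSpace G P)]
  [∀ x, TopologicalSpace (P x)] [FiberBundle G P]

variable (E G P) in
/-- The charts of the total space of a fibre bundle given by a trivialization of the bundle and a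
chart of the typical fibre. -/
def totalSpaceChart (i : FiberBundle.trivializationAtlas G P × G) :
    OpenPartialHomeomorph (TotalSpace G P) (B × E) :=
  i.1.1.toOpenPartialHomeomorph.trans ((OpenPartialHomeomorph.refl B).prod (chartAt E i.2))

lemma mem_totalSpaceChart_source {i : FiberBundle.trivializationAtlas G P × G}
    {z : TotalSpace G P} : z ∈ (totalSpaceChart E G P i).source ↔
      z.1 ∈ i.1.1.baseSet ∧ (i.1.1 z).2 ∈ (chartAt E i.2).source := by
  simp [totalSpaceChart, Trivialization.mem_source]

end TotalSpaceCharts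

section BundleSections

variable {X : Type*} [NormedAddCommGroup X] [NormedSpace ℝ X] {Ω : Opens X}
  {E : Type*} [NormedAddCommGroup E] [NormedSpace ℝ E]

lemma LipschitzNear.of_contMDiffAt {F : Type*} [NormedAddCommGroup F] [NormedSpace ℝ F]
    {f : Ω × E → F} {p : Ω × E}
    (hf : ContMDiffAt (𝓘(ℝ, X).prod 𝓘(ℝ, E)) 𝓘(ℝ, F) 1 f p) : LipschitzNear f p := by
  have hchart : ContDiffAt ℝ 1 (fun y : X × E => f ((chartAt X p.1).symm y.1, y.2))
      ((p.1 : X), p.2) := by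
    rw [← contDiffWithinAt_univ, ← ModelWithCorners.range_eq_univ (𝓘(ℝ, X).prod 𝓘(ℝ, E))]
    exact (contMDiffAt_iff.1 hf).2
  have hval : LipschitzNear (fun q : Ω × E => ((q.1 : X), q.2)) p :=
    .prodMk (((LipschitzWith.subtype_val _).comp LipschitzWith.prod_fst).locallyLipschitz p)
      (LipschitzWith.prod_snd.locallyLipschitz p)
  refine ((LipschitzNear.of_contDiffAt hchart).comp (u := fun q : Ω × E => ((q.1 : X), q.2))
    hval).congr (Eventually.of_forall fun q => ?_)
  have hq : q.1 ∈ (chartAt X p.1).source := by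
    rw [TopologicalSpace.Opens.chartAt_eq, OpenPartialHomeomorph.subtypeRestr_source]
    exact mem_univ _
  exact congrArg (fun y => f (y, q.2)) ((chartAt X p.1).left_inv hq).symm

variable {G : Type*} [TopologicalSpace G] [ChartedSpace E G]
  {P : Ω → Type*} [TopologicalSpace (TotalSpace G P)] [∀ x, TopologicalSpace (P x)]
  [FiberBundle G P]

variable [IsManifold 𝓘(ℝ, E) 1 G] [IsContMDiffFiberBundle Ω E G 1 P]

lemma contMDiffAt_totalSpaceChart_change {i j : FiberBundle.trivializationAtlas G P × G}
    {z : TotalSpace G P} (hi : z ∈ (totalSpaceChart E G P i).source)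
    (hj : z ∈ (totalSpaceChart E G P j).source) :
    ContMDiffAt (𝓘(ℝ, X).prod 𝓘(ℝ, E)) 𝓘(ℝ, E) 1
      (fun q => (totalSpaceChart E G P j ((totalSpaceChart E G P i).symm q)).2)
      (totalSpaceChart E G P i z) := by
  obtain ⟨hi_base, hi_chart⟩ := mem_totalSpaceChart_source.1 hi
  obtain ⟨hj_base, hj_chart⟩ := mem_totalSpaceChart_source.1 hj
  obtain ⟨⟨e, he⟩, a⟩ := i
  obtain ⟨⟨e', he'⟩, a'⟩ := j
  have hz : totalSpaceChart E G P (⟨e, he⟩, a) z = (z.1, chartAt E a (e z).2) :=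
    Prod.ext (e.coe_fst' hi_base) rfl
  have ha : (chartAt E a).symm (chartAt E a (e z).2) = (e z).2 := (chartAt E a).left_inv hi_chart
  have hsymm : ContMDiffAt (𝓘(ℝ, X).prod 𝓘(ℝ, E)) (𝓘(ℝ, X).prod 𝓘(ℝ, E)) 1
      (fun q : Ω × E => (q.1, (chartAt E a).symm q.2)) (z.1, chartAt E a (e z).2) :=
    contMDiffAt_fst.prodMk ((contMDiffOn_chart_symm.contMDiffAt
      ((chartAt E a).open_target.mem_nhds ((chartAt E a).map_source hi_chart))).comp
        (z.1, chartAt E a (e z).2) contMDiffAt_snd)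
  have hchange : ContMDiffAt (𝓘(ℝ, X).prod 𝓘(ℝ, E)) 𝓘(ℝ, E) 1
      (fun p : Ω × G => (e' (e.toOpenPartialHomeomorph.symm p)).2) (z.1, (e z).2) :=
    (IsContMDiffFiberBundle.contMDiffOn_coordChange e he e' he').contMDiffAt
      (((e.open_baseSet.inter e'.open_baseSet).prod isOpen_univ).mem_nhds
        ⟨⟨hi_base, hj_base⟩, mem_univ _⟩)
  have hchart : ContMDiffAt 𝓘(ℝ, E) 𝓘(ℝ, E) 1 (chartAt E a') (e' z).2 :=
    contMDiffOn_chart.contMDiffAt ((chartAt E a').open_source.mem_nhds hj_chart)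
  rw [hz]
  refine (hchart.comp_of_eq hchange ?_).comp_of_eq hsymm ?_
  · exact congrArg (fun w => (e' w).2) (trivialization_symm_mk_snd e hi_base z.2)
  · exact Prod.ext rfl ha

variable (E G P) in
lemma isLipschitzAtlas_totalSpaceChart :
    IsLipschitzAtlas (fun z : TotalSpace G P => z.1) (totalSpaceChart E G P) where
  continuous_proj := FiberBundle.continuous_proj G P
  fst_eq i _ hz := i.1.1.coe_fst' (mem_totalSpaceChart_source.1 hz).1
  cover z := ⟨(⟨FiberBundle.trivializationAt G P z.1, FiberBundle.trivialization_mem_atlas G P z.1⟩,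
    (FiberBundle.trivializationAt G P z.1 z).2), mem_totalSpaceChart_source.2
      ⟨FiberBundle.mem_baseSet_trivializationAt G P z.1, mem_chart_source E _⟩⟩
  lipschitzNear_change _ _ _ hi hj := .of_contMDiffAt (contMDiffAt_totalSpaceChart_change hi hj)

variable (E) in
theorem exists_isLocallyLipschitzSection_mem [SeparableSpace X] {f : ∀ x, P x}
    (hf : IsContinuousSection G f) {W : Set (TotalSpace G P)} (hW : IsOpen W)
    (hfW : ∀ x, ⟨x, f x⟩ ∈ W) :
    ∃ g : ∀ x, P x, IsLocallyLipschitzSection E G g ∧ IsContinuousSection G g ∧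
      ∀ x, ⟨x, g x⟩ ∈ W := by
  have : SecondCountableTopology X := UniformSpace.secondCountable_of_separable X
  obtain ⟨s, ⟨hs, hproj, hsW⟩, hlip⟩ :=
    (isLipschitzAtlas_totalSpaceChart E G P).exists_isSectionInto_lipschitzSectionAt hW
      (s := fun x => (⟨x, f x⟩ : TotalSpace G P)) ⟨hf, fun _ => rfl, hfW⟩
  have hfiber (x : Ω) : ∃ b : P x, s x = ⟨x, b⟩ := by
    have hx := hproj x
    generalize s x = z at hx
    obtain ⟨y, b⟩ := z
    obtain rfl : y = x := hx
    exact ⟨b, rfl⟩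
  choose g hg using hfiber
  obtain rfl : s = fun x => (⟨x, g x⟩ : TotalSpace G P) := funext hg
  refine ⟨g, fun e he x hx => ⟨?_, ?_⟩, hs, hsW⟩
  · exact continuousAt_snd_trivialization e (u := fun x => x) hx hs.continuousAt
  · exact hlip x (⟨e, he⟩, (e ⟨x, g x⟩).2) (mem_totalSpaceChart_source.2 ⟨hx, mem_chart_source E _⟩)

end BundleSections

end

section Torsors

variable {A Q : Type*} [Group A] [MulAction Aᵐᵒᵖ Q] {p : Q}

lemma op_torsorDiv_smul (hp : Function.Surjective fun a : A => op a • p) (q : Q) :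
    op (torsorDiv p q : A) • p = q :=
  Classical.epsilon_spec (hp q)

lemma torsorDiv_self (hp : Function.Bijective fun a : A => op a • p) : (torsorDiv p p : A) = 1 :=
  hp.1 ((op_torsorDiv_smul hp.2 p).trans (one_smul Aᵐᵒᵖ p).symm)

end Torsors

section PrincipalBundles

variable {X : Type*} [NormedAddCommGroup X] [NormedSpace ℝ X] {Ω : Opens X}
  {E : Type*} [NormedAddCommGroup E] [NormedSpace ℝ E]
  {G : Type*} [TopologicalSpace G] [ChartedSpace E G]
  {P : Ω → Type*} [TopologicalSpace (TotalSpace G P)] [∀ x, TopologicalSpace (P x)]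
  [FiberBundle G P] {m n : WithTop ℕ∞}

lemma IsContMDiffFiberBundle.of_le [IsContMDiffFiberBundle Ω E G n P] (h : m ≤ n) :
    IsContMDiffFiberBundle Ω E G m P where
  contMDiffOn_coordChange e he e' he' :=
    (IsContMDiffFiberBundle.contMDiffOn_coordChange e he e' he' : ContMDiffOn _ _ n _ _).of_le h

variable [Group G]
  {Γ : Ω → Type*} [TopologicalSpace (TotalSpace G Γ)] [∀ x, TopologicalSpace (Γ x)]
  [∀ x, Group (Γ x)] [FiberBundle G Γ] [∀ x, MulAction (Γ x)ᵐᵒᵖ (P x)]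

lemma IsRightPrincipalBundle.of_le [IsRightPrincipalBundle Ω E G n Γ P] (h : m ≤ n) :
    IsRightPrincipalBundle Ω E G m Γ P where
  toIsContMDiffFiberBundle := .of_le h
  exists_equivariant := IsRightPrincipalBundle.exists_equivariant E n

section Continuity

variable (E G n) in
lemma bijective_op_smul [IsRightPrincipalBundle Ω E G n Γ P] {x : Ω} (p : P x) :
    Function.Bijective fun a : Γ x => op a • p := by
  obtain ⟨e, -, τ, -, hx, h⟩ :=
    IsRightPrincipalBundle.exists_equivariant (E := E) (G := G) (n := n) (Γ := Γ) (P := P) x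
  refine (Function.Bijective.of_comp_iff' (bijective_trivialization_snd e hx.1) _).1 ?_
  have hcomp : ((fun b : P x => (e ⟨x, b⟩).2) ∘ fun a : Γ x => op a • p) =
      ((e ⟨x, p⟩).2 * ·) ∘ fun a => (τ ⟨x, a⟩).2 := funext (h x hx p)
  rw [hcomp]
  exact (Group.mulLeft_bijective _).comp (bijective_trivialization_snd τ hx.2)

variable [IsTopologicalGroup G] {S : Type*} [TopologicalSpace S] {u : S → Ω} {p : ∀ t, P (u t)}

variable (E n) in
lemma continuous_op_smul [IsRightPrincipalBundle Ω E G n Γ P] {a : ∀ t, Γ (u t)}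
    (hp : Continuous fun t => (⟨u t, p t⟩ : TotalSpace G P))
    (ha : Continuous fun t => (⟨u t, a t⟩ : TotalSpace G Γ)) :
    Continuous fun t => (⟨u t, op (a t) • p t⟩ : TotalSpace G P) := by
  have hu : Continuous u := (FiberBundle.continuous_proj G P).comp hp
  refine continuous_iff_continuousAt.2 fun t₀ => ?_
  obtain ⟨e, -, τ, -, hx, h⟩ := IsRightPrincipalBundle.exists_equivariant (E := E) (G := G) (n := n)
    (Γ := Γ) (P := P) (u t₀)
  refine continuousAt_totalSpace_mk e hu.continuousAt hx.1
    (((continuousAt_snd_trivialization e hx.1 hp.continuousAt).mul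
      (continuousAt_snd_trivialization τ hx.2 ha.continuousAt)).congr ?_)
  filter_upwards [hu.continuousAt ((e.open_baseSet.inter τ.open_baseSet).mem_nhds hx)] with t ht
  exact (h _ ht _ _).symm

variable (E n) in
lemma continuous_torsorDiv [IsRightPrincipalBundle Ω E G n Γ P] {q : ∀ t, P (u t)}
    (hp : Continuous fun t => (⟨u t, p t⟩ : TotalSpace G P))
    (hq : Continuous fun t => (⟨u t, q t⟩ : TotalSpace G P)) :
    Continuous fun t => (⟨u t, torsorDiv (p t) (q t)⟩ : TotalSpace G Γ) := by
  have hu : Continuous u := (FiberBundle.continuous_proj G P).comp hp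
  refine continuous_iff_continuousAt.2 fun t₀ => ?_
  obtain ⟨e, -, τ, -, hx, h⟩ := IsRightPrincipalBundle.exists_equivariant (E := E) (G := G) (n := n)
    (Γ := Γ) (P := P) (u t₀)
  refine continuousAt_totalSpace_mk τ hu.continuousAt hx.2
    (((continuousAt_snd_trivialization e hx.1 hp.continuousAt).inv.mul
      (continuousAt_snd_trivialization e hx.1 hq.continuousAt)).congr ?_)
  filter_upwards [hu.continuousAt ((e.open_baseSet.inter τ.open_baseSet).mem_nhds hx)] with t ht
  have hq_eq := h _ ht (p t) (torsorDiv (p t) (q t))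
  rw [op_torsorDiv_smul (bijective_op_smul E G n (p t)).2] at hq_eq
  exact inv_mul_eq_of_eq_mul hq_eq

end Continuity

variable [IsLieGroupBundle Ω E G 3 Γ] [LieGroup 𝓘(ℝ, E) 3 G]
  {N : Set (TotalSpace E (LieFiber E G Γ))}

namespace IsNormalNeighborhood

lemma mono (hN : IsNormalNeighborhood E G Γ N) {N' : Set (TotalSpace E (LieFiber E G Γ))}
    (hsub : N' ⊆ N) (hN' : IsOpen N')
    (hzero : ∀ x : Ω, (⟨x, 0⟩ : TotalSpace E (LieFiber E G Γ)) ∈ N') :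
    IsNormalNeighborhood E G Γ N' where
  isOpen := hN'
  zero_mem := hzero
  isOpenEmbedding := hN.isOpenEmbedding.comp
    (.inclusion hsub (hN'.preimage continuous_subtype_val))

lemma isOpen_image_bundleExp (hN : IsNormalNeighborhood E G Γ N) : IsOpen (bundleExp E G Γ '' N) :=
  range_domRestrict (bundleExp E G Γ) N ▸ hN.isOpenEmbedding.isOpen_range

lemma fiberLog_fiberExp (hN : IsNormalNeighborhood E G Γ N) {x : Ω} {v : LieFiber E G Γ x}
    (hv : v ∈ fiberPart N x) : fiberLog N x (fiberExp E G Γ x v) = v := by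
  refine InjOn.leftInvOn_invFunOn (fun v hv w hw hvw => ?_) hv
  have hres : N.domRestrict (bundleExp E G Γ) ⟨⟨x, v⟩, hv⟩ =
      N.domRestrict (bundleExp E G Γ) ⟨⟨x, w⟩, hw⟩ := congrArg (TotalSpace.mk x) hvw
  exact TotalSpace.mk_injective x (congrArg Subtype.val (hN.isOpenEmbedding.injective hres))

lemma continuous_of_continuous_fiberExp (hN : IsNormalNeighborhood E G Γ N)
    {S : Type*} [TopologicalSpace S] {u : S → Ω} {v : ∀ t, LieFiber E G Γ (u t)}
    (hv : ∀ t, v t ∈ fiberPart N (u t))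
    (hexp : Continuous fun t => (⟨u t, fiberExp E G Γ (u t) (v t)⟩ : TotalSpace G Γ)) :
    Continuous fun t => (⟨u t, v t⟩ : TotalSpace E (LieFiber E G Γ)) :=
  continuous_subtype_val.comp
    ((hN.isOpenEmbedding.isInducing.continuous_iff (f := fun t => (⟨⟨u t, v t⟩, hv t⟩ : N))).2 hexp)

lemma exists_isLocallyLipschitzSection_torsorDiv_mem [SeparableSpace X]
    [IsRightPrincipalBundle Ω E G 1 Γ P] (hN : IsNormalNeighborhood E G Γ N) {f : ∀ x, P x}
    (hf : IsContinuousSection G f) :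
    ∃ g : ∀ x, P x, IsLocallyLipschitzSection E G g ∧ IsContinuousSection G g ∧
      ∀ x, torsorDiv (f x) (g x) ∈ fiberExp E G Γ x '' fiberPart N x := by
  have : IsManifold 𝓘(ℝ, E) 1 G := .of_le (n := 3) (by norm_num)
  have : IsTopologicalGroup G := topologicalGroup_of_lieGroup 𝓘(ℝ, E) 3
  have hdiv : Continuous fun p : TotalSpace G P =>
      (⟨p.1, torsorDiv (f p.1) p.2⟩ : TotalSpace G Γ) :=
    continuous_torsorDiv E 1 (u := fun p : TotalSpace G P => p.1)
      (Continuous.comp hf (FiberBundle.continuous_proj G P)) continuous_id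
  obtain ⟨g, hg, hg_cont, hgW⟩ := exists_isLocallyLipschitzSection_mem E hf
    (hN.isOpen_image_bundleExp.preimage hdiv) fun x => ⟨⟨x, 0⟩, hN.zero_mem x, by
      simp only [bundleExp, fiberExp_zero, torsorDiv_self (bijective_op_smul E G 1 (f x))]⟩
  refine ⟨g, hg, hg_cont, fun x => ?_⟩
  obtain ⟨⟨y, v⟩, hv, hvx⟩ := hgW x
  obtain rfl : y = x := congrArg (fun z : TotalSpace G Γ => z.1) hvx
  exact ⟨v, hv, TotalSpace.mk_injective y hvx⟩

theorem exists_isLocallyLipschitzSection_fiberLog_le [SeparableSpace X]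
    [IsRightPrincipalBundle Ω E G 1 Γ P] (hN : IsNormalNeighborhood E G Γ N)
    {q : ∀ x : Ω, Seminorm ℝ (LieFiber E G Γ x)}
    (hq : Continuous fun v : TotalSpace E (LieFiber E G Γ) => q v.1 v.2) {f : ∀ x, P x}
    (hf : IsContinuousSection G f) {ε : Ω → ℝ} (hε : Continuous ε) (hε_pos : ∀ x, 0 < ε x) :
    ∃ g : ∀ x, P x, IsLocallyLipschitzSection E G g ∧
      ∀ x, torsorDiv (f x) (g x) ∈ fiberExp E G Γ x '' fiberPart N x ∧
        q x (fiberLog N x (torsorDiv (f x) (g x))) ≤ ε x := by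
  have hNε : IsNormalNeighborhood E G Γ (N ∩ {v | q v.1 v.2 < ε v.1}) :=
    hN.mono inter_subset_left
      (hN.isOpen.inter (isOpen_lt hq (hε.comp (FiberBundle.continuous_proj E (LieFiber E G Γ)))))
      fun x => ⟨hN.zero_mem x, (map_zero (q x)).trans_lt (hε_pos x)⟩
  obtain ⟨g, hg, -, hmem⟩ := hNε.exists_isLocallyLipschitzSection_torsorDiv_mem hf
  refine ⟨g, hg, fun x => ?_⟩
  obtain ⟨v, ⟨hvN, hvε⟩, hvx⟩ := hmem x
  rw [← hvx, hN.fiberLog_fiberExp hvN]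
  exact ⟨⟨v, hvN, rfl⟩, le_of_lt hvε⟩

end IsNormalNeighborhood

lemma continuous_smul_section {v : ∀ x, LieFiber E G Γ x}
    (hv : Continuous fun x => (⟨x, v x⟩ : TotalSpace E (LieFiber E G Γ))) :
    Continuous fun p : Ω × unitInterval =>
      (⟨p.1, (p.2 : ℝ) • v p.1⟩ : TotalSpace E (LieFiber E G Γ)) := by
  refine continuous_iff_continuousAt.2 fun p => ?_
  let L := (lieAlgebraBundle E G Γ).localTriv ((lieAlgebraBundle E G Γ).indexAt p.1)
  have hp : p.1 ∈ L.baseSet := (lieAlgebraBundle E G Γ).mem_baseSet_at p.1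
  have hL : ContinuousAt (fun x => (L ⟨x, v x⟩).2) p.1 :=
    continuousAt_snd_trivialization L (u := fun x => x) hp hv.continuousAt
  have hsmul : ContinuousAt (fun q : Ω × unitInterval => (q.2 : ℝ) • (L ⟨q.1, v q.1⟩).2) p :=
    (continuous_subtype_val.comp continuous_snd).continuousAt.smul
      (hL.comp (f := Prod.fst) continuousAt_fst)
  refine continuousAt_totalSpace_mk L continuousAt_fst hp
    (hsmul.congr (Eventually.of_forall fun q => ?_))
  simp only [L, VectorBundleCore.localTriv_apply]
  exact (ContinuousLinearMap.map_smul _ (q.2 : ℝ) (v q.1)).symm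

variable (Γ) in
theorem exists_homotopy_isLocallyLipschitzSection [SeparableSpace X] [CompleteSpace E]
    [IsRightPrincipalBundle Ω E G 1 Γ P] {f : ∀ x, P x} (hf : IsContinuousSection G f) :
    ∃ g : ∀ x, P x, IsLocallyLipschitzSection E G g ∧
      ∃ h : ∀ x, unitInterval → P x,
        (Continuous fun p : Ω × unitInterval => (⟨p.1, h p.1 p.2⟩ : TotalSpace G P)) ∧
        ∀ x, h x 0 = f x ∧ h x 1 = g x := by
  have : IsTopologicalGroup G := topologicalGroup_of_lieGroup 𝓘(ℝ, E) 3
  obtain ⟨N, hN, hstar⟩ := exists_isNormalNeighborhood_starConvex E G Γ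
  obtain ⟨g, hg, hg_cont, hmem⟩ := hN.exists_isLocallyLipschitzSection_torsorDiv_mem hf
  choose v hvN hv_exp using hmem
  have hv : Continuous fun x => (⟨x, v x⟩ : TotalSpace E (LieFiber E G Γ)) :=
    hN.continuous_of_continuous_fiberExp (u := fun x => x) hvN (by
      simp only [hv_exp]
      exact continuous_torsorDiv E 1 hf hg_cont)
  have hexp : Continuous fun p : Ω × unitInterval =>
      (⟨p.1, fiberExp E G Γ p.1 ((p.2 : ℝ) • v p.1)⟩ : TotalSpace G Γ) :=
    hN.isOpenEmbedding.continuous.comp ((continuous_smul_section hv).subtype_mk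
      fun p => (hstar p.1).smul_mem (hvN p.1) p.2.2.1 p.2.2.2)
  refine ⟨g, hg, fun x t => op (fiberExp E G Γ x ((t : ℝ) • v x)) • f x,
    continuous_op_smul E 1 (u := fun p : Ω × unitInterval => p.1)
      (Continuous.comp hf continuous_fst) hexp, fun x => ⟨?_, ?_⟩⟩
  · simp only [Icc.coe_zero, zero_smul, fiberExp_zero, op_one, one_smul]
  · simp only [Icc.coe_one, one_smul, hv_exp]
    exact op_torsorDiv_smul (bijective_op_smul E G 1 (f x)).2 (g x)

end PrincipalBundles

theorem theorem8p2_general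
    {X : Type*} [NormedAddCommGroup X] [NormedSpace ℝ X] [SeparableSpace X] {Ω : Opens X}
    {E : Type*} [NormedAddCommGroup E] [NormedSpace ℝ E] [CompleteSpace E]
    {G : Type*} [TopologicalSpace G] [ChartedSpace E G] [Group G] [LieGroup 𝓘(ℝ, E) 3 G]
    (Γ : Ω → Type*) [TopologicalSpace (TotalSpace G Γ)] [∀ x, TopologicalSpace (Γ x)]
    [∀ x, Group (Γ x)] [FiberBundle G Γ] [IsLieGroupBundle Ω E G 3 Γ]
    {q : ∀ x : Ω, Seminorm ℝ (LieFiber E G Γ x)}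
    (hq : Continuous fun v : TotalSpace E (LieFiber E G Γ) => q v.1 v.2)
    (P : Ω → Type*) [TopologicalSpace (TotalSpace G P)] [∀ x, TopologicalSpace (P x)]
    [FiberBundle G P] [∀ x, MulAction (Γ x)ᵐᵒᵖ (P x)] [IsRightPrincipalBundle Ω E G 1 Γ P] :
    (∃ N, IsNormalNeighborhood E G Γ N) ∧
    (∀ N, IsNormalNeighborhood E G Γ N →
      ∀ f : ∀ x, P x, IsContinuousSection G f →
      ∀ ε : Ω → ℝ, Continuous ε → (∀ x, 0 < ε x) →
        ∃ g : ∀ x, P x, IsLocallyLipschitzSection E G g ∧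
          ∀ x, torsorDiv (f x) (g x) ∈ fiberExp E G Γ x '' fiberPart N x ∧
            q x (fiberLog N x (torsorDiv (f x) (g x))) ≤ ε x) ∧
    (∀ f : ∀ x, P x, IsContinuousSection G f →
      ∃ g : ∀ x, P x, IsLocallyLipschitzSection E G g ∧
        ∃ h : ∀ x, unitInterval → P x,
          (Continuous fun p : Ω × unitInterval => (⟨p.1, h p.1 p.2⟩ : TotalSpace G P)) ∧
          ∀ x, h x 0 = f x ∧ h x 1 = g x) :=
  ⟨(exists_isNormalNeighborhood_starConvex E G Γ).imp fun _ hN => hN.1,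
    fun _ hN _ hf _ hε hε_pos =>
      hN.exists_isLocallyLipschitzSection_fiberLog_le hq hf hε hε_pos,
    fun _ hf => exists_homotopy_isLocallyLipschitzSection Γ hf⟩

theorem theorem8p2
    {X : Type*} [NormedAddCommGroup X] [NormedSpace ℝ X] [CompleteSpace X] [SeparableSpace X]
    (Ω : Opens X)
    {E : Type*} [NormedAddCommGroup E] [NormedSpace ℝ E] [CompleteSpace E]
    {G : Type*} [TopologicalSpace G] [ChartedSpace E G] [Group G] [LieGroup 𝓘(ℝ, E) 3 G]
    (Γ : Ω → Type*) [TopologicalSpace (TotalSpace G Γ)] [∀ x, TopologicalSpace (Γ x)]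
    [∀ x, Group (Γ x)] [FiberBundle G Γ] [IsLieGroupBundle Ω E G 3 Γ]
    (nrm : ContinuousNorm E G Γ)
    (P : Ω → Type*) [TopologicalSpace (TotalSpace G P)] [∀ x, TopologicalSpace (P x)]
    [FiberBundle G P] [∀ x, MulAction (Γ x)ᵐᵒᵖ (P x)] [IsRightPrincipalBundle Ω E G 3 Γ P] :
    -- normal neighbourhoods exist, so that the logarithm is defined
    (∃ N, IsNormalNeighborhood E G Γ N) ∧
    -- approximation of continuous sections by locally Lipschitz ones
    (∀ N, IsNormalNeighborhood E G Γ N →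
      ∀ f : ∀ x, P x, IsContinuousSection G f →
      ∀ ε : Ω → ℝ, Continuous ε → (∀ x, 0 < ε x) →
        ∃ g : ∀ x, P x, IsLocallyLipschitzSection E G g ∧
          ∀ x, torsorDiv (f x) (g x) ∈ fiberExp E G Γ x '' fiberPart N x ∧
            nrm.toFun x (fiberLog N x (torsorDiv (f x) (g x))) ≤ ε x) ∧
    -- homotopy of continuous sections to locally Lipschitz ones
    (∀ f : ∀ x, P x, IsContinuousSection G f →
      ∃ g : ∀ x, P x, IsLocallyLipschitzSection E G g ∧
        ∃ h : ∀ x, unitInterval → P x,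
          (Continuous fun p : Ω × unitInterval => (⟨p.1, h p.1 p.2⟩ : TotalSpace G P)) ∧
          ∀ x, h x 0 = f x ∧ h x 1 = g x) := by
  have : IsRightPrincipalBundle Ω E G 1 Γ P := .of_le (n := 3) (by norm_num)
  exact theorem8p2_general Γ nrm.continuous P
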